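/- Let $\mathbb{D}=\{|z|<1\}$, $\mathbb{T}=\{|z|=1\}$, and let $A$ be the normalized area measure on $\mathbb{D}$. A holomorphic function $f$ on $\mathbb{D}$ belongs to $BMOA$ if $\|f\|_{BMOA}=\inf\|g\|_{L^\infty(\mathbb{T})}<\infty$, where the infimum is over all $g\in L^\infty(\mathbb{T})$ (with respect to arc length) such that $f(\xi)=\frac{1}{2\pi i}\int_{\mathbb{T}}\frac{g(u)}{u-\xi}\,du$ for all $\xi\in\mathbb{D}$ (with $\inf\emptyset=\infty$). For $1\le p<\infty$ and $\alpha>-1$, a holomorphic function $f$ on $\mathbb{D}$ belongs to $A_p^1(\alpha)$ if $$\|f\|_{A_p^1(\alpha)}=|f(0)|+\left(\int_{\mathbb{D}}(1-|u|^2)^{\alpha}|f'(u)|^p\,dA(u)\right)^{1/p}<\infty .$$ Let $\alpha>-1$ and $1\le p<\infty$. Then $BMOA\subset A_p^1(\alpha)$ if and only if either $\alpha>p-1$, or $\alpha=p-1$ and $p\ge 2$. Moreover, whenever the inclusion holds it is a continuous embedding: there is a constant $C<\infty$, depending only on $p$ and $\alpha$, such that $\|f\|_{A_p^1(\alpha)}\le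 C\,\|f\|_{BMOA}$ for all $f\in BMOA$. -/

import Mathlib

open MeasureTheory Metric
open scoped ENNReal NNReal

noncomputable section

/-! Functions on the open unit disc `ball (0 : ℂ) 1` are represented by functions `ℂ → ℂ`, of which
only the restriction to the disc matters: every notion below depends on that restriction only. -/

/-- Arc length on the unit circle, as a measure on `ℂ` carried by the circle. -/
def arcMeasure : Measure ℂ :=
  (volume.restrict (Set.Ioc 0 (2 * Real.pi))).map (circleMap 0 1)

/-- The normalized area measure on the open unit disc. -/
def diskArea : Measure ℂ :=
  (ENNReal.ofReal Real.pi)⁻¹ • volume.restrict (ball (0 : ℂ) 1)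

/-- `f` is the Cauchy integral of `g ∈ L^∞(𝕋)` on the unit disc. -/
def IsCauchyIntegralOf (f g : ℂ → ℂ) : Prop :=
  MemLp g ⊤ arcMeasure ∧
    ∀ ξ ∈ ball (0 : ℂ) 1,
      f ξ = (2 * Real.pi * Complex.I)⁻¹ * ∮ u in C(0, 1), g u / (u - ξ)

/-- The `BMOA` norm: the infimum of the sup norms of all `g ∈ L^∞(𝕋)` whose Cauchy integral is `f`
(it is `∞` if there is no such `g`). -/
def bmoaNorm (f : ℂ → ℂ) : ℝ≥0∞ :=
  ⨅ (g : ℂ → ℂ) (_ : IsCauchyIntegralOf f g), eLpNorm g ⊤ arcMeasure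

/-- The space `BMOA`. -/
def BMOA : Set (ℂ → ℂ) :=
  {f | DifferentiableOn ℂ f (ball 0 1) ∧ bmoaNorm f < ⊤}

/-- The norm of the weighted Bergman space `A_p(α)`, with weight `(1 - |u|²)^α`. -/
def bergmanNorm (p α : ℝ) (f : ℂ → ℂ) : ℝ≥0∞ :=
  (∫⁻ u, ENNReal.ofReal ((1 - ‖u‖ ^ 2) ^ α) * ‖f u‖ₑ ^ p ∂diskArea) ^ (1 / p)

/-- The norm of `A_p^1(α)`. -/
def bergmanSobolevNorm (p α : ℝ) (f : ℂ → ℂ) : ℝ≥0∞ :=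
  ‖f 0‖ₑ + bergmanNorm p α (deriv f)

/-- The space `A_p^1(α)` of holomorphic functions on the disc whose derivative is in `A_p(α)`. -/
def bergmanSobolev (p α : ℝ) : Set (ℂ → ℂ) :=
  {f | DifferentiableOn ℂ f (ball 0 1) ∧ bergmanSobolevNorm p α f < ⊤}

end

/-! Let `f` be the Cauchy integral of `g`, with `M` the sup norm of `g` and `c n` its Fourier
coefficients. Those with `n ≥ 0` are the Taylor coefficients of `f`.

Sufficiency. The derivative is `g` integrated against the squared Cauchy kernel, whose modulus has
mean `1 / (1 - |z|²)`. This gives the Bloch bound `(1 - |z|²) |f'(z)| ≤ M`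
(`IsCauchyIntegralOf.enorm_deriv_le`). For `α > p - 1` nothing more is needed, since `(1 - |u|²) ^
(α - p)` is integrable. For `α = p - 1` and `p ≥ 2` the Bloch bound absorbs the power `p - 2` of
`|f'|`, and a Littlewood–Paley inequality (`IsCauchyIntegralOf.lintegral_deriv_sq_le`) handles the
remaining square.

Necessity. At distance about `1 / n` from the circle the mean of `|f'|` is at least a constant times
`n |c n|`. For `n = 3 ^ k` the corresponding annuli are disjoint, so the inclusion forces `∑ 3 ^ (k
(p - 1 - α)) |c (3 ^ k)| ^ p < ∞` for every continuous `g`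
(`IsCauchyIntegralOf.tsum_circleCoeff_three_pow_le`). Banach–Steinhaus makes such statements uniform
in `g`. If `α < p - 1`, the characters `u ^ (3 ^ k)` contradict the uniform bound. If `α = p - 1`
and `p < 2`, Riesz products do: their sup norm is controlled by the `ℓ²` norm of the real sequence
`b`, while their coefficients at `3 ^ k` are `b k * I / 2`, and `ℓ²` is not contained in `ℓ^q` for
`q < 2`. -/

open scoped BoundedContinuousFunction

/-! ### Fourier coefficients and Parseval's identity. -/

/-- The Fourier coefficients of a `2π`-periodic function. -/
noncomputable def circleCoeff (G : ℝ → ℂ) (n : ℤ) : ℂ :=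
  (2 * Real.pi : ℂ)⁻¹ * ∫ t in (0 : ℝ)..2 * Real.pi, Complex.exp (-(n * t * Complex.I)) * G t

theorem circleCoeff_eq_fourierCoeffOn (G : ℝ → ℂ) (n : ℤ) :
    circleCoeff G n = fourierCoeffOn Real.two_pi_pos G n := by
  rw [fourierCoeffOn_eq_integral, circleCoeff, Complex.real_smul]
  congr 1
  · push_cast; simp
  · refine intervalIntegral.integral_congr fun t _ => ?_
    have hpi : (Real.pi : ℂ) ≠ 0 := by exact_mod_cast Real.pi_ne_zero
    simp only [fourier_coe_apply, smul_eq_mul]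
    congr 2
    push_cast
    field_simp
    ring

theorem circleCoeff_congr {F G : ℝ → ℂ} (h : ∀ t, F t = G t) (n : ℤ) :
    circleCoeff F n = circleCoeff G n := by
  rw [funext h]

theorem hasSum_sq_circleCoeff {G : ℝ → ℂ}
    (hG : MemLp G 2 (volume.restrict (Set.Ioc 0 (2 * Real.pi)))) :
    HasSum (fun n : ℤ => ‖circleCoeff G n‖ ^ 2)
      ((2 * Real.pi)⁻¹ * ∫ t in (0 : ℝ)..2 * Real.pi, ‖G t‖ ^ 2) := by
  simpa [circleCoeff_eq_fourierCoeffOn] using hasSum_sq_fourierCoeffOn Real.two_pi_pos hG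

theorem integral_exp_int_mul (m : ℤ) :
    ∫ t in (0 : ℝ)..2 * Real.pi, Complex.exp (m * t * Complex.I) =
      if m = 0 then (2 * Real.pi : ℂ) else 0 := by
  split_ifs with h
  · subst h; simp
  · have hc : (m * Complex.I : ℂ) ≠ 0 := by simp [h]
    have := integral_exp_mul_complex (a := 0) (b := 2 * Real.pi) hc
    simp_rw [show ∀ t : ℝ, (m * t * Complex.I : ℂ) = m * Complex.I * t from fun t => by ring]
    rw [this]
    have h1 : Complex.exp (m * Complex.I * ((2 * Real.pi : ℝ) : ℂ)) = 1 := by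
      rw [Complex.exp_eq_one_iff]; exact ⟨m, by push_cast; ring⟩
    rw [h1]; simp

theorem circleCoeff_exp (n m : ℤ) :
    circleCoeff (fun t => Complex.exp (m * t * Complex.I)) n = if m = n then 1 else 0 := by
  have hpi : (2 * Real.pi : ℂ) ≠ 0 := by exact_mod_cast Real.two_pi_pos.ne'
  have := integral_exp_int_mul (m - n)
  rw [circleCoeff]
  simp_rw [← Complex.exp_add]
  simp_rw [show ∀ t : ℝ, (-(n * t * Complex.I) + m * t * Complex.I : ℂ)
    = ((m - n : ℤ) : ℂ) * t * Complex.I from fun t => by push_cast; ring]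
  rw [this]
  simp only [sub_eq_zero]
  split_ifs
  · exact inv_mul_cancel₀ hpi
  · simp

/-- Multiplication by a character shifts the Fourier coefficients. -/
theorem circleCoeff_exp_mul (G : ℝ → ℂ) (n m : ℤ) :
    circleCoeff (fun t => Complex.exp (m * t * Complex.I) * G t) n = circleCoeff G (n - m) := by
  rw [circleCoeff, circleCoeff]
  congr 1
  refine intervalIntegral.integral_congr fun t _ => ?_
  rw [← mul_assoc, ← Complex.exp_add]
  congr 2
  push_cast
  ring

theorem circleCoeff_add {F G : ℝ → ℂ} (hF : Continuous F) (hG : Continuous G) (n : ℤ) :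
    circleCoeff (fun t => F t + G t) n = circleCoeff F n + circleCoeff G n := by
  simp only [circleCoeff, ← mul_add]
  rw [← intervalIntegral.integral_add]
  · simp only [mul_add]
  · exact Continuous.intervalIntegrable (by fun_prop) _ _
  · exact Continuous.intervalIntegrable (by fun_prop) _ _

theorem circleCoeff_const_mul (c : ℂ) (G : ℝ → ℂ) (n : ℤ) :
    circleCoeff (fun t => c * G t) n = c * circleCoeff G n := by
  simp only [circleCoeff]
  rw [mul_left_comm, ← intervalIntegral.integral_const_mul c]
  congr 1
  exact intervalIntegral.integral_congr fun t _ => by ring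

theorem norm_circleCoeff_le {G : ℝ → ℂ} {M : ℝ} (h : ∀ t, ‖G t‖ ≤ M) (n : ℤ) :
    ‖circleCoeff G n‖ ≤ M := by
  have h1 : ‖∫ t in (0 : ℝ)..2 * Real.pi, Complex.exp (-(n * t * Complex.I)) * G t‖ ≤
      M * |2 * Real.pi - 0| := by
    refine intervalIntegral.norm_integral_le_of_norm_le_const fun t _ => ?_
    rw [norm_mul, show (-(n * t * Complex.I) : ℂ) = ((-(n * t) : ℝ) : ℂ) * Complex.I by
      push_cast; ring, Complex.norm_exp_ofReal_mul_I, one_mul]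
    exact h t
  rw [sub_zero, abs_of_pos Real.two_pi_pos] at h1
  rw [circleCoeff, norm_mul, norm_inv]
  have : ‖(2 * Real.pi : ℂ)‖ = 2 * Real.pi := by
    simp [abs_of_pos Real.pi_pos]
  rw [this, inv_mul_le_iff₀ Real.two_pi_pos]
  linarith

/-- Fourier coefficients of an absolutely convergent series, integrated against a bounded
function. -/
theorem hasSum_circleCoeff {G : ℝ → ℂ} {d : ℕ → ℂ} (e : ℕ → ℤ) (hd : Summable fun k => ‖d k‖)
    (hG : IntervalIntegrable G volume 0 (2 * Real.pi)) (n : ℤ) :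
    HasSum (fun k : ℕ => d k * circleCoeff G (n - e k))
      (circleCoeff (fun t => (∑' k, d k * Complex.exp (e k * t * Complex.I)) * G t) n) := by
  have hexp : ∀ (m : ℤ) (t : ℝ), ‖Complex.exp (m * t * Complex.I)‖ = 1 := fun m t => by
    rw [show (m * t * Complex.I : ℂ) = ((m * t : ℝ) : ℂ) * Complex.I by push_cast; ring,
      Complex.norm_exp_ofReal_mul_I]
  have hexp' : ∀ (m : ℤ) (t : ℝ), ‖Complex.exp (-(m * t * Complex.I))‖ = 1 := fun m t => by
    have := hexp (-m) t
    push_cast at this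
    simpa using this
  have hG' := (intervalIntegrable_iff_integrableOn_Ioc_of_le Real.two_pi_pos.le).1 hG
  set μ := volume.restrict (Set.Ioc 0 (2 * Real.pi)) with hμ
  have key := MeasureTheory.hasSum_integral_of_summable_integral_norm (μ := μ) (E := ℂ)
    (F := fun (k : ℕ) (t : ℝ) => d k * (Complex.exp (-(n * t * Complex.I)) *
      (Complex.exp (e k * t * Complex.I) * G t))) ?_ ?_
  · simp only [circleCoeff]
    have e1 : ∀ k : ℕ, d k * ((2 * Real.pi : ℂ)⁻¹ * ∫ t in (0 : ℝ)..2 * Real.pi,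
        Complex.exp (-(((n - e k : ℤ) : ℂ) * t * Complex.I)) * G t) = (2 * Real.pi : ℂ)⁻¹ *
        ∫ t, d k * (Complex.exp (-(n * t * Complex.I)) *
          (Complex.exp (e k * t * Complex.I) * G t)) ∂μ := fun k => by
      rw [mul_left_comm, intervalIntegral.integral_of_le Real.two_pi_pos.le, integral_const_mul]
      congr 2
      refine integral_congr_ae (μ := μ) (Filter.Eventually.of_forall fun t => ?_)
      beta_reduce
      rw [← mul_assoc, ← Complex.exp_add]
      congr 2
      push_cast
      ring
    simp_rw [e1]
    refine HasSum.mul_left _ ?_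
    rw [intervalIntegral.integral_of_le Real.two_pi_pos.le]
    refine Eq.subst (motive := fun x => HasSum _ x) ?_ key
    refine integral_congr_ae (μ := μ) (Filter.Eventually.of_forall fun t => ?_)
    simp only
    rw [← tsum_mul_right, ← tsum_mul_left]
    refine tsum_congr fun k => ?_
    ring
  · intro k
    refine Integrable.const_mul ?_ _
    refine Integrable.bdd_mul (c := 1) ?_ (by fun_prop) (Filter.Eventually.of_forall fun t => (hexp' n t).le)
    exact Integrable.bdd_mul (c := 1) hG' (by fun_prop)
      (Filter.Eventually.of_forall fun t => (hexp (e k) t).le)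
  · have : ∀ (k : ℕ), ∫ t, ‖d k * (Complex.exp (-(n * t * Complex.I)) *
        (Complex.exp (e k * t * Complex.I) * G t))‖ ∂μ = ‖d k‖ * ∫ t, ‖G t‖ ∂μ := fun k => by
      rw [← integral_const_mul]
      congr 1
      ext t
      have := hexp (e k) t
      rw [norm_mul, norm_mul, norm_mul, hexp', this, one_mul, one_mul]
    simp_rw [this]
    exact hd.mul_right _

theorem circleCoeff_tsum {d : ℕ → ℂ} (hd : Summable fun k => ‖d k‖) (n : ℕ) :
    circleCoeff (fun t => ∑' k, d k * Complex.exp (k * t * Complex.I)) n = d n := by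
  have h := hasSum_circleCoeff (G := fun _ => 1) (fun k => (k : ℤ)) hd (by simp) n
  have h1 : ∀ m : ℤ, circleCoeff (fun _ => 1) m = if m = 0 then 1 else 0 := fun m => by
    have := circleCoeff_exp m 0
    simpa [eq_comm] using this
  simp only [mul_one, h1, Int.cast_natCast] at h
  refine h.unique ?_
  convert hasSum_ite_eq n (d n) using 2 with k
  by_cases hk : k = n
  · simp [hk]
  · have : (n : ℤ) - k ≠ 0 := by omega
    simp [hk, this]

theorem circleCoeff_tsum_of_neg {d : ℕ → ℂ} (hd : Summable fun k => ‖d k‖) {n : ℤ} (hn : n < 0) :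
    circleCoeff (fun t => ∑' k, d k * Complex.exp (k * t * Complex.I)) n = 0 := by
  have h := hasSum_circleCoeff (G := fun _ => 1) (fun k => (k : ℤ)) hd (by simp) n
  have h1 : ∀ m : ℤ, circleCoeff (fun _ => 1) m = if m = 0 then 1 else 0 := fun m => by
    have := circleCoeff_exp m 0
    simpa [eq_comm] using this
  simp only [mul_one, h1, Int.cast_natCast] at h
  refine h.unique ?_
  convert hasSum_zero using 2 with k
  have : n - k ≠ 0 := by omega
  simp [this]

theorem continuous_tsum_exp {d : ℕ → ℂ} (hd : Summable fun k => ‖d k‖) :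
    Continuous fun t : ℝ => ∑' k, d k * Complex.exp (k * t * Complex.I) := by
  refine continuous_tsum (fun k => by fun_prop) hd fun k t => ?_
  rw [norm_mul, show (k * t * Complex.I : ℂ) = ((k * t : ℝ) : ℂ) * Complex.I by push_cast; ring,
      Complex.norm_exp_ofReal_mul_I, mul_one]

theorem Continuous.memLp_Ioc {G : ℝ → ℂ} (hG : Continuous G) (p : ℝ≥0∞) (a b : ℝ) :
    MemLp G p (volume.restrict (Set.Ioc a b)) := by
  obtain ⟨C, hC⟩ := (isCompact_Icc (a := a) (b := b)).exists_bound_of_continuousOn hG.continuousOn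
  refine MemLp.of_bound hG.aestronglyMeasurable C ?_
  exact (ae_restrict_iff' measurableSet_Ioc).2
    (Filter.Eventually.of_forall fun t ht => hC t (Set.Ioc_subset_Icc_self ht))

/-- **Parseval's identity**. -/
theorem tsum_enorm_sq_circleCoeff {G : ℝ → ℂ}
    (hG : MemLp G 2 (volume.restrict (Set.Ioc 0 (2 * Real.pi)))) :
    ∑' n : ℤ, ‖circleCoeff G n‖ₑ ^ 2 =
      (ENNReal.ofReal (2 * Real.pi))⁻¹ * ∫⁻ t in Set.Ioc 0 (2 * Real.pi), ‖G t‖ₑ ^ 2 := by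
  have h := hasSum_sq_circleCoeff hG
  have h3 : ∫⁻ t in Set.Ioc 0 (2 * Real.pi), ‖G t‖ₑ ^ 2 =
      ENNReal.ofReal (∫ t in (0 : ℝ)..2 * Real.pi, ‖G t‖ ^ 2) := by
    rw [intervalIntegral.integral_of_le Real.two_pi_pos.le, ofReal_integral_eq_lintegral_ofReal]
    · refine lintegral_congr fun t => ?_
      rw [ENNReal.ofReal_pow (norm_nonneg _), ofReal_norm]
    · exact hG.integrable_norm_pow (by norm_num)
    · exact Filter.Eventually.of_forall fun t => by positivity
  rw [h3, ← ENNReal.ofReal_inv_of_pos Real.two_pi_pos, ← ENNReal.ofReal_mul (by positivity),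
    ← h.tsum_eq, ENNReal.ofReal_tsum_of_nonneg (fun k => by positivity) h.summable]
  refine tsum_congr fun k => ?_
  rw [ENNReal.ofReal_pow (norm_nonneg _), ofReal_norm]

/-- **Parseval's identity** for an absolutely convergent series of characters. -/
theorem lintegral_enorm_tsum_sq {d : ℕ → ℂ} (hd : Summable fun k => ‖d k‖) :
    ∫⁻ t in Set.Ioc 0 (2 * Real.pi), ‖∑' k, d k * Complex.exp (k * t * Complex.I)‖ₑ ^ 2 =
      ENNReal.ofReal (2 * Real.pi) * ∑' k, ‖d k‖ₑ ^ 2 := by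
  have h := tsum_enorm_sq_circleCoeff ((continuous_tsum_exp hd).memLp_Ioc 2 _ _)
  have hinj : Function.Injective (fun k : ℕ => (k : ℤ)) := Nat.cast_injective
  rw [← hinj.tsum_eq] at h
  · simp only [circleCoeff_tsum hd] at h
    rw [h, ← mul_assoc, ENNReal.mul_inv_cancel, one_mul]
    · simp [Real.pi_pos]
    · exact ENNReal.ofReal_ne_top
  · intro n hn
    by_contra hcon
    have : n < 0 := by
      by_contra hcon'
      exact hcon ⟨n.toNat, by simp; omega⟩
    simp [circleCoeff_tsum_of_neg hd this] at hn

theorem enorm_circleCoeff_le (G : ℝ → ℂ) (n : ℤ) :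
    ‖circleCoeff G n‖ₑ ≤
      (ENNReal.ofReal (2 * Real.pi))⁻¹ * ∫⁻ t in Set.Ioc 0 (2 * Real.pi), ‖G t‖ₑ := by
  rw [circleCoeff, enorm_mul, intervalIntegral.integral_of_le Real.two_pi_pos.le]
  have h1 : ‖(2 * Real.pi : ℂ)⁻¹‖ₑ = (ENNReal.ofReal (2 * Real.pi))⁻¹ := by
    rw [← ofReal_norm, ← ENNReal.ofReal_inv_of_pos Real.two_pi_pos]
    simp [abs_of_pos Real.pi_pos]
  rw [h1]
  gcongr
  refine (enorm_integral_le_lintegral_enorm _).trans (lintegral_mono fun t => ?_)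
  rw [enorm_mul, ← ofReal_norm, show (-(n * t * Complex.I) : ℂ) =
    ((-(n * t) : ℝ) : ℂ) * Complex.I by push_cast; ring, Complex.norm_exp_ofReal_mul_I]
  simp

/-- Parseval, with the negative frequencies dropped and the quadratic mean bounded by the essential
supremum. -/
theorem tsum_enorm_sq_circleCoeff_le {G : ℝ → ℂ}
    (hG : MemLp G ⊤ (volume.restrict (Set.Ioc 0 (2 * Real.pi)))) :
    ∑' n : ℕ, ‖circleCoeff G n‖ₑ ^ 2 ≤
      eLpNorm G ⊤ (volume.restrict (Set.Ioc 0 (2 * Real.pi))) ^ 2 := by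
  have hinj : Function.Injective (fun k : ℕ => (k : ℤ)) := Nat.cast_injective
  refine (ENNReal.tsum_comp_le_tsum_of_injective hinj (fun n => ‖circleCoeff G n‖ₑ ^ 2)).trans ?_
  rw [tsum_enorm_sq_circleCoeff (hG.mono_exponent le_top)]
  rw [ENNReal.inv_mul_le_iff (by simp [Real.pi_pos]) ENNReal.ofReal_ne_top]
  calc ∫⁻ t in Set.Ioc 0 (2 * Real.pi), ‖G t‖ₑ ^ 2
      ≤ ∫⁻ t in Set.Ioc 0 (2 * Real.pi),
        eLpNorm G ⊤ (volume.restrict (Set.Ioc 0 (2 * Real.pi))) ^ 2 := by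
        refine lintegral_mono_ae ?_
        filter_upwards [ae_le_eLpNormEssSup (f := G)
          (μ := volume.restrict (Set.Ioc 0 (2 * Real.pi)))] with t ht
        rw [eLpNorm_exponent_top]
        gcongr
    _ = _ := by
        rw [lintegral_const, Measure.restrict_apply_univ, Real.volume_Ioc, sub_zero, mul_comm]

theorem enorm_circleCoeff_le_eLpNorm {G : ℝ → ℂ}
    (hG : MemLp G ⊤ (volume.restrict (Set.Ioc 0 (2 * Real.pi)))) (n : ℕ) :
    ‖circleCoeff G n‖ₑ ≤ eLpNorm G ⊤ (volume.restrict (Set.Ioc 0 (2 * Real.pi))) := by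
  have := (ENNReal.le_tsum n).trans (tsum_enorm_sq_circleCoeff_le hG)
  exact (ENNReal.pow_le_pow_left_iff two_ne_zero).1 this

/-! ### Cauchy integrals of bounded functions: Taylor coefficients and the Bloch estimate. -/

namespace IsCauchyIntegralOf

variable {f g : ℂ → ℂ}

theorem memLp (h : IsCauchyIntegralOf f g) :
    MemLp (fun t => g (circleMap 0 1 t)) ⊤ (volume.restrict (Set.Ioc 0 (2 * Real.pi))) :=
  (memLp_map_measure_iff h.1.1 (by fun_prop)).1 h.1

theorem eLpNorm_eq (h : IsCauchyIntegralOf f g) :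
    eLpNorm (fun t => g (circleMap 0 1 t)) ⊤ (volume.restrict (Set.Ioc 0 (2 * Real.pi))) =
      eLpNorm g ⊤ arcMeasure :=
  (eLpNorm_map_measure h.1.1 (by fun_prop)).symm

theorem intervalIntegrable (h : IsCauchyIntegralOf f g) :
    IntervalIntegrable (fun t => g (circleMap 0 1 t)) volume 0 (2 * Real.pi) :=
  (intervalIntegrable_iff_integrableOn_Ioc_of_le Real.two_pi_pos.le).2 (h.memLp.integrable le_top)

theorem hasFPowerSeriesOnBall (h : IsCauchyIntegralOf f g) :
    HasFPowerSeriesOnBall f (cauchyPowerSeries g 0 1) 0 1 := by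
  have h1 := hasFPowerSeriesOn_cauchy_integral (f := g) (c := 0) (R := 1) h.intervalIntegrable
    one_pos
  refine HasFPowerSeriesOnBall.congr h1 fun ξ hξ => ?_
  have hξ' : ξ ∈ ball (0 : ℂ) 1 := by simpa [Metric.mem_eball, edist_zero_right, ← ofReal_norm] using hξ
  rw [h.2 ξ hξ', smul_eq_mul]
  congr 2
  ext u
  simp [div_eq_inv_mul]

/-- With `u = exp (i t)` one has `du = i u dt`, so `u ^ (-n - 1) du` becomes `i exp (-i n t) dt`. -/
theorem coeff_cauchyPowerSeries (g : ℂ → ℂ) (n : ℕ) :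
    (cauchyPowerSeries g 0 1).coeff n = circleCoeff (fun t => g (circleMap 0 1 t)) n := by
  have h := cauchyPowerSeries_apply g 0 1 n 1
  rw [FormalMultilinearSeries.coeff, Pi.one_def, h, circleIntegral_def_Icc, circleCoeff,
    smul_eq_mul, integral_Icc_eq_integral_Ioc, ← intervalIntegral.integral_of_le Real.two_pi_pos.le]
  have hI : (2 * Real.pi * Complex.I : ℂ)⁻¹ = (2 * Real.pi : ℂ)⁻¹ * Complex.I⁻¹ := mul_inv _ _
  rw [hI, mul_assoc, ← intervalIntegral.integral_const_mul Complex.I⁻¹]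
  congr 1
  refine intervalIntegral.integral_congr fun t _ => ?_
  have h0 : Complex.exp (t * Complex.I) ≠ 0 := Complex.exp_ne_zero _
  simp only [deriv_circleMap, circleMap_zero, sub_zero, smul_eq_mul, Complex.ofReal_one, one_mul,
    one_div, inv_pow, ← Complex.exp_nat_mul]
  rw [Complex.exp_neg]
  simp only [Int.cast_natCast, mul_assoc]
  field_simp

theorem differentiableOn (h : IsCauchyIntegralOf f g) : DifferentiableOn ℂ f (ball 0 1) := by
  have h1 := h.hasFPowerSeriesOnBall.differentiableOn
  have h2 : eball (0 : ℂ) 1 = ball 0 1 := by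
    ext z
    simp [← ofReal_norm, ENNReal.ofReal_lt_one]
  rwa [h2] at h1

theorem apply_zero (h : IsCauchyIntegralOf f g) :
    f 0 = circleCoeff (fun t => g (circleMap 0 1 t)) 0 := by
  have h1 := h.hasFPowerSeriesOnBall.coeff_zero 0
  have h2 := coeff_cauchyPowerSeries g 0
  rw [FormalMultilinearSeries.coeff] at h2
  rw [Nat.cast_zero] at h2
  rw [← h1, ← h2]
  congr 1
  exact Subsingleton.elim _ _

theorem hasSum_deriv (h : IsCauchyIntegralOf f g) {z : ℂ} (hz : ‖z‖ < 1) :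
    HasSum (fun k : ℕ => (k + 1) * circleCoeff (fun t => g (circleMap 0 1 t)) (k + 1) * z ^ k)
      (deriv f z) := by
  have hz' : z ∈ eball (0 : ℂ) 1 := by
    simpa [Metric.mem_eball, edist_zero_right, ← ofReal_norm] using hz
  have h1 := h.hasFPowerSeriesOnBall.fderiv.hasSum hz'
  have h2 := ((ContinuousLinearMap.apply ℂ ℂ (1 : ℂ)).hasSum h1)
  simp only [zero_add] at h2
  refine Eq.subst (motive := fun F => HasSum F (deriv f z)) ?_ h2
  funext k
  have h3 := FormalMultilinearSeries.derivSeries_coeff_one (cauchyPowerSeries g 0 1) k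
  rw [coeff_cauchyPowerSeries] at h3
  simp only [ContinuousLinearMap.apply_apply,
    FormalMultilinearSeries.apply_eq_pow_smul_coeff, smul_apply, h3]
  simp [mul_comm]

theorem norm_circleCoeff_le (h : IsCauchyIntegralOf f g) (n : ℕ) :
    ‖circleCoeff (fun t => g (circleMap 0 1 t)) n‖ ≤ (eLpNorm g ⊤ arcMeasure).toReal := by
  have h1 := enorm_circleCoeff_le_eLpNorm h.memLp n
  rw [h.eLpNorm_eq] at h1
  simpa using ENNReal.toReal_mono h.1.2.ne h1

theorem summable_norm (h : IsCauchyIntegralOf f g) {r : ℝ} (hr : 0 ≤ r) (hr1 : r < 1) :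
    Summable fun k : ℕ =>
      ‖((k + 1) * circleCoeff (fun t => g (circleMap 0 1 t)) (k + 1) * r ^ k : ℂ)‖ := by
  have hs : Summable fun k : ℕ => (((k + 1).choose 1 : ℕ) : ℝ) * r ^ k :=
    (hasSum_choose_mul_geometric_of_norm_lt_one 1 (by rwa [Real.norm_of_nonneg hr])).summable
  refine Summable.of_nonneg_of_le (fun k => norm_nonneg _) (fun k => ?_)
    (hs.mul_right (eLpNorm g ⊤ arcMeasure).toReal)
  have h1 := h.norm_circleCoeff_le (k + 1)
  push_cast at h1
  have h2 : ‖((k : ℂ) + 1)‖ = k + 1 := by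
    rw [← Nat.cast_add_one, Complex.norm_natCast]; push_cast; rfl
  rw [norm_mul, norm_mul, h2, norm_pow, Complex.norm_real, Real.norm_of_nonneg hr,
    Nat.choose_one_right]
  push_cast
  calc _ ≤ (k + 1 : ℝ) * (eLpNorm g ⊤ arcMeasure).toReal * r ^ k := by gcongr
    _ = _ := by ring

theorem deriv_circleMap_eq (h : IsCauchyIntegralOf f g) {r : ℝ} (hr : 0 ≤ r) (hr1 : r < 1)
    (t : ℝ) :
    deriv f (circleMap 0 r t) = ∑' k : ℕ, ((k + 1) *
      circleCoeff (fun t => g (circleMap 0 1 t)) (k + 1) * r ^ k : ℂ) *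
        Complex.exp (k * t * Complex.I) := by
  rw [← (h.hasSum_deriv (z := circleMap 0 r t) (by simpa [abs_of_nonneg hr] using hr1)).tsum_eq]
  refine tsum_congr fun k => ?_
  rw [circleMap_zero, mul_pow, ← Complex.exp_nat_mul, mul_assoc, mul_assoc, mul_assoc, mul_assoc]

/-- **Parseval's identity** for the Cauchy kernel. -/
theorem _root_.lintegral_enorm_cauchyKernel_sq {z : ℂ} (hz : ‖z‖ < 1) :
    ∫⁻ t in Set.Ioc 0 (2 * Real.pi), ‖(1 - z * Complex.exp (-(t * Complex.I)))⁻¹‖ₑ ^ 2 =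
      ENNReal.ofReal (2 * Real.pi) * (ENNReal.ofReal (1 - ‖z‖ ^ 2))⁻¹ := by
  have hs : Summable fun k : ℕ => ‖(starRingEnd ℂ z) ^ k‖ := by
    simpa using summable_geometric_of_norm_lt_one (x := ‖z‖) (by simpa using hz)
  have h := lintegral_enorm_tsum_sq hs
  have e1 : ∀ t : ℝ, ‖∑' k : ℕ, (starRingEnd ℂ z) ^ k * Complex.exp (k * t * Complex.I)‖ₑ =
      ‖(1 - z * Complex.exp (-(t * Complex.I)))⁻¹‖ₑ := fun t => by
    have h1 : ‖starRingEnd ℂ z * Complex.exp (t * Complex.I)‖ < 1 := by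
      simpa [Complex.norm_exp_ofReal_mul_I] using hz
    simp_rw [mul_assoc, Complex.exp_nat_mul, ← mul_pow]
    rw [tsum_geometric_of_norm_lt_one h1, ← ofReal_norm, ← ofReal_norm]
    congr 1
    rw [← RCLike.norm_conj]
    simp [← Complex.exp_conj]
  simp_rw [e1] at h
  rw [h]
  congr 1
  have e2 : ∀ k : ℕ, ‖(starRingEnd ℂ z) ^ k‖ₑ ^ 2 = (ENNReal.ofReal (‖z‖ ^ 2)) ^ k := fun k => by
    rw [← ofReal_norm, ← ENNReal.ofReal_pow (norm_nonneg _), ← ENNReal.ofReal_pow (by positivity)]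
    simp [← pow_mul, mul_comm]
  simp_rw [e2]
  rw [ENNReal.tsum_geometric, ENNReal.ofReal_sub _ (by positivity), ENNReal.ofReal_one]

/-- Functions in `BMOA` are Bloch functions. -/
theorem enorm_deriv_le (h : IsCauchyIntegralOf f g) {z : ℂ} (hz : ‖z‖ < 1) :
    ENNReal.ofReal (1 - ‖z‖ ^ 2) * ‖deriv f z‖ₑ ≤ eLpNorm g ⊤ arcMeasure := by
  set G : ℝ → ℂ := fun t => g (circleMap 0 1 t) with hG
  have hs : Summable fun k : ℕ => ‖((k + 1) * z ^ k : ℂ)‖ := by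
    have hs : Summable fun k : ℕ => (((k + 1).choose 1 : ℕ) : ℝ) * ‖z‖ ^ k :=
      (hasSum_choose_mul_geometric_of_norm_lt_one 1 (by rwa [norm_norm])).summable
    refine hs.congr fun k => ?_
    rw [norm_mul, norm_pow, Nat.choose_one_right, ← Nat.cast_add_one, Complex.norm_natCast]
  have h1 := hasSum_circleCoeff (G := G) (fun k => -(k : ℤ)) hs h.intervalIntegrable 1
  -- The differentiated Cauchy formula: the `k`-th term of the kernel carries `exp (-i k t)`, which
  -- shifts the index `1` to `k + 1`. By `h3` the kernel sums to `(1 - z exp (-i t))⁻²`.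
  have h2 : deriv f z = circleCoeff (fun t =>
      (∑' k : ℕ, ((k + 1) * z ^ k : ℂ) * Complex.exp ((-(k : ℤ) : ℤ) * t * Complex.I)) * G t) 1 := by
    refine (h.hasSum_deriv hz).unique ?_
    convert h1 using 2 with k
    rw [sub_neg_eq_add, add_comm (1 : ℤ)]
    ring
  have h3 : ∀ t : ℝ, ∑' k : ℕ, ((k + 1) * z ^ k : ℂ) *
      Complex.exp ((-(k : ℤ) : ℤ) * t * Complex.I) =
      ((1 - z * Complex.exp (-(t * Complex.I)))⁻¹) ^ 2 := fun t => by
    have hz' : ‖z * Complex.exp (-(t * Complex.I))‖ < 1 := by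
      rw [norm_mul, show (-(t * Complex.I) : ℂ) = ((-t : ℝ) : ℂ) * Complex.I by push_cast; ring,
        Complex.norm_exp_ofReal_mul_I, mul_one]
      exact hz
    have := (hasSum_choose_mul_geometric_of_norm_lt_one 1 hz').tsum_eq
    rw [one_div] at this
    rw [inv_pow, ← this]
    refine tsum_congr fun k => ?_
    rw [Nat.choose_one_right, mul_pow, ← Complex.exp_nat_mul]
    push_cast
    rw [mul_assoc]
    congr 3
    ring_nf
  simp_rw [h3] at h2
  have hpos : 0 < 1 - ‖z‖ ^ 2 := by nlinarith [norm_nonneg z]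
  have h4 : ‖deriv f z‖ₑ ≤ (ENNReal.ofReal (2 * Real.pi))⁻¹ *
      ((ENNReal.ofReal (2 * Real.pi) * (ENNReal.ofReal (1 - ‖z‖ ^ 2))⁻¹) *
        eLpNorm g ⊤ arcMeasure) := by
    rw [h2, ← lintegral_enorm_cauchyKernel_sq hz, ← h.eLpNorm_eq]
    refine (enorm_circleCoeff_le _ _).trans ?_
    gcongr
    rw [← lintegral_mul_const' _ _ h.memLp.2.ne]
    refine lintegral_mono_ae ?_
    filter_upwards [ae_le_eLpNormEssSup (f := G)
          (μ := volume.restrict (Set.Ioc 0 (2 * Real.pi)))] with t ht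
    rw [enorm_mul, enorm_pow, eLpNorm_exponent_top]
    gcongr
  calc _ ≤ ENNReal.ofReal (1 - ‖z‖ ^ 2) * ((ENNReal.ofReal (2 * Real.pi))⁻¹ *
      ((ENNReal.ofReal (2 * Real.pi) * (ENNReal.ofReal (1 - ‖z‖ ^ 2))⁻¹) *
        eLpNorm g ⊤ arcMeasure)) := by gcongr
    _ = ((ENNReal.ofReal (2 * Real.pi))⁻¹ * ENNReal.ofReal (2 * Real.pi)) *
      (ENNReal.ofReal (1 - ‖z‖ ^ 2) * (ENNReal.ofReal (1 - ‖z‖ ^ 2))⁻¹) *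
        eLpNorm g ⊤ arcMeasure := by ring
    _ = _ := by
      rw [ENNReal.inv_mul_cancel (by simp [Real.pi_pos]) ENNReal.ofReal_ne_top,
        ENNReal.mul_inv_cancel (by simpa using hpos) ENNReal.ofReal_ne_top, one_mul, one_mul]

end IsCauchyIntegralOf

/-! ### Area integrals and the sufficiency of the conditions. -/

/-- The area measure of the disc in polar coordinates. -/
theorem lintegral_diskArea {F : ℂ → ℝ≥0∞} (hF : Measurable F) :
    ∫⁻ u, F u ∂diskArea = (ENNReal.ofReal Real.pi)⁻¹ * ∫⁻ r in Set.Ioo (0 : ℝ) 1,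
      ENNReal.ofReal r * ∫⁻ t in Set.Ioc 0 (2 * Real.pi), F (circleMap 0 r t) := by
  rw [diskArea, lintegral_smul_measure, smul_eq_mul]
  congr 1
  have hsymm : ∀ p : ℝ × ℝ, Complex.polarCoord.symm p = circleMap 0 p.1 p.2 := fun p => by
    rw [Complex.polarCoord_symm_apply, circleMap_zero, Complex.exp_mul_I, Complex.ofReal_cos,
      Complex.ofReal_sin]
  have hperiod : ∀ r : ℝ, ∫⁻ t in Set.Ioo (-Real.pi) Real.pi, F (circleMap 0 r t) =
      ∫⁻ t in Set.Ioc 0 (2 * Real.pi), F (circleMap 0 r t) := fun r => by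
    rw [setLIntegral_congr Ioo_ae_eq_Ioc]
    have h1 := isAddFundamentalDomain_Ioc Real.two_pi_pos (-Real.pi) volume
    have h2 := isAddFundamentalDomain_Ioc Real.two_pi_pos 0 volume
    rw [show -Real.pi + 2 * Real.pi = Real.pi by ring] at h1
    rw [zero_add] at h2
    refine h1.setLIntegral_eq h2 _ ?_
    rintro ⟨_, n, rfl⟩ t
    have := (periodic_circleMap 0 r).zsmul n t
    simp only [AddSubgroup.vadd_def, vadd_eq_add]
    rw [add_comm, this]
  rw [← lintegral_indicator measurableSet_ball, ← Complex.lintegral_comp_polarCoord_symm,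
    polarCoord_target, Measure.volume_eq_prod, ← Measure.prod_restrict,
    lintegral_prod]
  · simp only [hsymm, smul_eq_mul]
    have : ∀ r ∈ Set.Ioi (0 : ℝ), ∫⁻ t in Set.Ioo (-Real.pi) Real.pi,
        ENNReal.ofReal r * (ball (0 : ℂ) 1).indicator F (circleMap 0 r t) =
        (Set.Ioo (0 : ℝ) 1).indicator (fun r => ENNReal.ofReal r *
          ∫⁻ t in Set.Ioc 0 (2 * Real.pi), F (circleMap 0 r t)) r := fun r hr => by
      rw [lintegral_const_mul' _ _ ENNReal.ofReal_ne_top]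
      have hr' : 0 < r := hr
      by_cases h1 : r < 1
      · have hm : ∀ t, circleMap 0 r t ∈ ball (0 : ℂ) 1 := fun t => by
          simpa [abs_of_pos hr'] using h1
        simp only [Set.indicator_of_mem (hm _), Set.indicator_of_mem (Set.mem_Ioo.2 ⟨hr', h1⟩),
          hperiod]
      · have hm : ∀ t, circleMap 0 r t ∉ ball (0 : ℂ) 1 := fun t => by
          simpa [abs_of_pos hr'] using h1
        have hm' : r ∉ Set.Ioo (0 : ℝ) 1 := fun h => h1 h.2
        simp [Set.indicator_of_notMem (hm _), Set.indicator_of_notMem hm']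
    rw [setLIntegral_congr_fun measurableSet_Ioi this, lintegral_indicator measurableSet_Ioo,
      Measure.restrict_restrict measurableSet_Ioo]
    congr 2
    ext r
    simp +contextual
  · refine Measurable.aemeasurable ?_
    simp only [hsymm, smul_eq_mul]
    refine Measurable.mul (by fun_prop) ((hF.indicator measurableSet_ball).comp ?_)
    simp only [circleMap_zero]
    fun_prop

theorem setLIntegral_Ioo_ofReal_eq {φ : ℝ → ℝ} (hφ : Continuous φ) {a b : ℝ} (hab : a ≤ b)
    (h0 : ∀ r ∈ Set.Ioo a b, 0 ≤ φ r) :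
    ∫⁻ r in Set.Ioo a b, ENNReal.ofReal (φ r) = ENNReal.ofReal (∫ r in a..b, φ r) := by
  rw [intervalIntegral.integral_of_le hab, integral_Ioc_eq_integral_Ioo,
    ofReal_integral_eq_lintegral_ofReal]
  · exact (hφ.integrableOn_Icc).mono_set Set.Ioo_subset_Icc_self
  · exact (ae_restrict_iff' measurableSet_Ioo).2 (Filter.Eventually.of_forall h0)

/-- The integral equals `(k + 1) / (k + 2)`. It is the weight of the squared coefficient of index `k
+ 1` in the Littlewood–Paley integral. -/
theorem lintegral_radial_monomial_le (k : ℕ) :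
    ∫⁻ r in Set.Ioo (0 : ℝ) 1,
      ENNReal.ofReal (2 * r * (1 - r ^ 2) * ((k + 1) * r ^ k) ^ 2) ≤ 1 := by
  rw [setLIntegral_Ioo_ofReal_eq (by fun_prop) zero_le_one]
  · have h1 : ∀ r : ℝ, 2 * r * (1 - r ^ 2) * ((k + 1) * r ^ k) ^ 2 =
        2 * (k + 1) ^ 2 * (r ^ (2 * k + 1) - r ^ (2 * k + 3)) := fun r => by ring
    simp_rw [h1]
    rw [intervalIntegral.integral_const_mul, intervalIntegral.integral_sub (by simp) (by simp),
      integral_pow, integral_pow, ← ENNReal.ofReal_one]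
    refine ENNReal.ofReal_le_ofReal ?_
    have : (0 : ℝ) ≤ k := k.cast_nonneg
    push_cast
    rw [one_pow, one_pow, zero_pow (by omega), zero_pow (by omega)]
    have e : 2 * ((k : ℝ) + 1) ^ 2 * ((1 - 0) / (2 * k + 1 + 1) - (1 - 0) / (2 * k + 3 + 1)) =
        (k + 1) / (k + 2) := by
      field_simp
      ring
    rw [e, div_le_one (by positivity)]
    linarith
  · intro r hr
    have : 0 ≤ 1 - r ^ 2 := by nlinarith [hr.1, hr.2]
    have := hr.1.le
    positivity

theorem measurable_one_sub_norm_sq_rpow (α : ℝ) :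
    Measurable fun u : ℂ => ENNReal.ofReal ((1 - ‖u‖ ^ 2) ^ α) := by
  fun_prop

namespace IsCauchyIntegralOf

variable {f g : ℂ → ℂ}

/-- A one-sided **Littlewood–Paley inequality**. -/
theorem lintegral_deriv_sq_le (h : IsCauchyIntegralOf f g) :
    ∫⁻ u, ENNReal.ofReal (1 - ‖u‖ ^ 2) * ‖deriv f u‖ₑ ^ 2 ∂diskArea ≤
      eLpNorm g ⊤ arcMeasure ^ 2 := by
  have hm := measurable_deriv f
  rw [lintegral_diskArea (by fun_prop)]
  set c : ℕ → ℂ := fun k => circleCoeff (fun t => g (circleMap 0 1 t)) (k + 1) with hc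
  have hpi : (ENNReal.ofReal Real.pi)⁻¹ * ENNReal.ofReal (2 * Real.pi) = 2 := by
    rw [mul_comm 2, ENNReal.ofReal_mul Real.pi_pos.le, ← mul_assoc,
      ENNReal.inv_mul_cancel (by simp [Real.pi_pos]) ENNReal.ofReal_ne_top, one_mul]
    simp
  have h1 : ∀ r ∈ Set.Ioo (0 : ℝ) 1, ENNReal.ofReal r * ∫⁻ t in Set.Ioc 0 (2 * Real.pi),
      ENNReal.ofReal (1 - ‖circleMap 0 r t‖ ^ 2) * ‖deriv f (circleMap 0 r t)‖ₑ ^ 2 =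
      ENNReal.ofReal Real.pi * ∑' k : ℕ, ENNReal.ofReal
        (2 * r * (1 - r ^ 2) * ((k + 1) * r ^ k) ^ 2) * ‖c k‖ₑ ^ 2 := fun r hr => by
    have hn : ∀ t, ‖circleMap 0 r t‖ = r := fun t => by simp [abs_of_pos hr.1]
    simp only [hn]
    have hr2 : 0 ≤ 1 - r ^ 2 := by nlinarith [hr.1, hr.2]
    rw [lintegral_const_mul' _ _ ENNReal.ofReal_ne_top]
    simp_rw [h.deriv_circleMap_eq hr.1.le hr.2]
    rw [lintegral_enorm_tsum_sq (h.summable_norm hr.1.le hr.2),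
      ← ENNReal.tsum_mul_left, ← ENNReal.tsum_mul_left, ← ENNReal.tsum_mul_left,
      ← ENNReal.tsum_mul_left]
    refine tsum_congr fun k => ?_
    have h2 : ‖((k + 1) * c k * r ^ k : ℂ)‖ₑ = ENNReal.ofReal ((k + 1) * r ^ k) * ‖c k‖ₑ := by
      have h2 : ‖((k : ℂ) + 1)‖ = k + 1 := by
        rw [← Nat.cast_add_one, Complex.norm_natCast]; push_cast; rfl
      rw [← ofReal_norm, ← ofReal_norm, ← ENNReal.ofReal_mul (by have := hr.1.le; positivity),
        norm_mul, norm_mul, h2, norm_pow, Complex.norm_real, Real.norm_of_nonneg hr.1.le]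
      ring_nf
    rw [h2, mul_pow, ← ENNReal.ofReal_pow (by have := hr.1.le; positivity)]
    have hrr := hr.1.le
    simp only [← mul_assoc]
    rw [← ENNReal.ofReal_mul hrr, ← ENNReal.ofReal_mul (by positivity),
      ← ENNReal.ofReal_mul (by positivity), ← ENNReal.ofReal_mul Real.pi_pos.le]
    congr 2
    ring
  rw [setLIntegral_congr_fun measurableSet_Ioo h1,
    lintegral_const_mul' _ _ ENNReal.ofReal_ne_top, ← mul_assoc,
    ENNReal.inv_mul_cancel (by simp [Real.pi_pos]) ENNReal.ofReal_ne_top, one_mul,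
    lintegral_tsum (fun k => by fun_prop)]
  calc ∑' k : ℕ, ∫⁻ r in Set.Ioo (0 : ℝ) 1, ENNReal.ofReal
        (2 * r * (1 - r ^ 2) * ((k + 1) * r ^ k) ^ 2) * ‖c k‖ₑ ^ 2
      ≤ ∑' k : ℕ, ‖c k‖ₑ ^ 2 := by
        refine ENNReal.tsum_le_tsum fun k => ?_
        rw [lintegral_mul_const' _ _ (by simp)]
        exact mul_le_of_le_one_left' (lintegral_radial_monomial_le k)
    _ ≤ ∑' k : ℕ, ‖circleCoeff (fun t => g (circleMap 0 1 t)) k‖ₑ ^ 2 := by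
        have := ENNReal.tsum_comp_le_tsum_of_injective (add_left_injective 1)
          (fun k : ℕ => ‖circleCoeff (fun t => g (circleMap 0 1 t)) k‖ₑ ^ 2)
        simpa [hc] using this
    _ ≤ _ := by
        rw [← h.eLpNorm_eq]
        exact tsum_enorm_sq_circleCoeff_le h.memLp

theorem enorm_apply_zero_le (h : IsCauchyIntegralOf f g) : ‖f 0‖ₑ ≤ eLpNorm g ⊤ arcMeasure := by
  rw [h.apply_zero, ← h.eLpNorm_eq]
  exact_mod_cast enorm_circleCoeff_le_eLpNorm h.memLp 0

theorem eLpNorm_lt_top (h : IsCauchyIntegralOf f g) : eLpNorm g ⊤ arcMeasure < ⊤ := h.1.2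

/-- The integrand factors as `((1 - |u|²) |f'|) ^ (p - 2)` times `(1 - |u|²) |f'|²`. As `p - 2 ≥ 0`,
the Bloch estimate bounds the first factor and Littlewood–Paley the integral of the second. -/
theorem bergmanNorm_deriv_le_of_two_le (h : IsCauchyIntegralOf f g) {p : ℝ} (hp : 2 ≤ p) :
    bergmanNorm p (p - 1) (deriv f) ≤ eLpNorm g ⊤ arcMeasure := by
  set M := eLpNorm g ⊤ arcMeasure with hM
  have hp0 : 0 < p := by linarith
  rw [bergmanNorm, one_div, ENNReal.rpow_inv_le_iff hp0]
  calc ∫⁻ u, ENNReal.ofReal ((1 - ‖u‖ ^ 2) ^ (p - 1)) * ‖deriv f u‖ₑ ^ p ∂diskArea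
      ≤ ∫⁻ u, M ^ (p - 2) *
          (ENNReal.ofReal (1 - ‖u‖ ^ 2) * ‖deriv f u‖ₑ ^ 2) ∂diskArea := by
        rw [diskArea, lintegral_smul_measure, lintegral_smul_measure]
        refine mul_le_mul_right (setLIntegral_mono' measurableSet_ball fun u hu => ?_) _
        have hu' : ‖u‖ < 1 := by simpa using hu
        have hpos : 0 < 1 - ‖u‖ ^ 2 := by nlinarith [norm_nonneg u]
        have e1 : ENNReal.ofReal ((1 - ‖u‖ ^ 2) ^ (p - 1)) =
            ENNReal.ofReal (1 - ‖u‖ ^ 2) ^ (p - 2) * ENNReal.ofReal (1 - ‖u‖ ^ 2) := by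
          rw [ENNReal.ofReal_rpow_of_pos hpos, ← ENNReal.ofReal_mul (by positivity)]
          congr 1
          rw [← Real.rpow_add_one hpos.ne']
          congr 1
          ring
        have e2 : ‖deriv f u‖ₑ ^ p = ‖deriv f u‖ₑ ^ (p - 2) * ‖deriv f u‖ₑ ^ 2 := by
          rw [← ENNReal.rpow_natCast, ← ENNReal.rpow_add_of_nonneg _ _ (by linarith) (by simp)]
          congr 1
          push_cast
          ring
        calc _ = (ENNReal.ofReal (1 - ‖u‖ ^ 2) * ‖deriv f u‖ₑ) ^ (p - 2) *
              (ENNReal.ofReal (1 - ‖u‖ ^ 2) * ‖deriv f u‖ₑ ^ 2) := by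
              rw [e1, e2, ENNReal.mul_rpow_of_nonneg _ _ (by linarith)]
              ring
          _ ≤ _ := by
              gcongr
              exact h.enorm_deriv_le hu'
    _ ≤ M ^ (p - 2) * M ^ 2 := by
        rw [lintegral_const_mul' _ _ (ENNReal.rpow_ne_top_of_nonneg (by linarith)
          h.eLpNorm_lt_top.ne)]
        gcongr
        exact h.lintegral_deriv_sq_le
    _ = M ^ p := by
        rw [← ENNReal.rpow_natCast, ← ENNReal.rpow_add_of_nonneg _ _ (by linarith) (by simp)]
        congr 1
        push_cast
        ring

/-- The Bloch estimate to the power `p`, integrated. The first factor is infinite unless `α - p >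
-1`. -/
theorem bergmanNorm_deriv_le_mul (h : IsCauchyIntegralOf f g) {p : ℝ} (hp : 1 ≤ p) (α : ℝ) :
    bergmanNorm p α (deriv f) ≤
      (∫⁻ u, ENNReal.ofReal ((1 - ‖u‖ ^ 2) ^ (α - p)) ∂diskArea) ^ (1 / p) *
        eLpNorm g ⊤ arcMeasure := by
  set M := eLpNorm g ⊤ arcMeasure with hM
  have hp0 : 0 < p := by linarith
  rw [bergmanNorm, one_div, ENNReal.rpow_inv_le_iff hp0, ENNReal.mul_rpow_of_nonneg _ _ hp0.le,
    ENNReal.rpow_inv_rpow hp0.ne', ← lintegral_mul_const' _ _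
      (ENNReal.rpow_ne_top_of_nonneg hp0.le h.eLpNorm_lt_top.ne)]
  rw [diskArea, lintegral_smul_measure, lintegral_smul_measure]
  refine mul_le_mul_right (setLIntegral_mono' measurableSet_ball fun u hu => ?_) _
  have hu' : ‖u‖ < 1 := by simpa using hu
  have hpos : 0 < 1 - ‖u‖ ^ 2 := by nlinarith [norm_nonneg u]
  have e1 : ENNReal.ofReal ((1 - ‖u‖ ^ 2) ^ α) =
      ENNReal.ofReal ((1 - ‖u‖ ^ 2) ^ (α - p)) * ENNReal.ofReal (1 - ‖u‖ ^ 2) ^ p := by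
    rw [ENNReal.ofReal_rpow_of_pos hpos, ← ENNReal.ofReal_mul (by positivity),
      ← Real.rpow_add hpos]
    congr 2
    ring
  rw [e1, mul_assoc, ← ENNReal.mul_rpow_of_nonneg _ _ hp0.le]
  gcongr
  exact h.enorm_deriv_le hu'

end IsCauchyIntegralOf

theorem lintegral_one_sub_norm_sq_rpow_lt_top {s : ℝ} (hs : -1 < s) :
    ∫⁻ u, ENNReal.ofReal ((1 - ‖u‖ ^ 2) ^ s) ∂diskArea < ⊤ := by
  rw [lintegral_diskArea (measurable_one_sub_norm_sq_rpow s)]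
  refine ENNReal.mul_lt_top (by simp [Real.pi_pos]) ?_
  -- The exponent `min s 0` serves both signs of `s`: the weight is at most `1` when `s ≥ 0`, and `1
  -- - r ≤ 1 - r ^ 2` gives the comparison when `s ≤ 0`.
  have hint : IntegrableOn (fun r : ℝ => (1 - r) ^ min s 0) (Set.Ioo 0 1) := by
    have h1 : IntervalIntegrable (fun r : ℝ => r ^ min s 0) volume 0 1 :=
      intervalIntegral.intervalIntegrable_rpow' (by simp [hs])
    have h2 := h1.comp_sub_left 1
    rw [sub_zero, sub_self] at h2
    exact ((intervalIntegrable_iff_integrableOn_Ioc_of_le zero_le_one).1 h2.symm).mono_set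
      Set.Ioo_subset_Ioc_self
  calc ∫⁻ r in Set.Ioo (0 : ℝ) 1, ENNReal.ofReal r * ∫⁻ t in Set.Ioc 0 (2 * Real.pi),
        ENNReal.ofReal ((1 - ‖circleMap 0 r t‖ ^ 2) ^ s)
      ≤ ∫⁻ r in Set.Ioo (0 : ℝ) 1,
        ENNReal.ofReal ((1 - r) ^ min s 0) * ENNReal.ofReal (2 * Real.pi) := by
        refine setLIntegral_mono' measurableSet_Ioo fun r hr => ?_
        have hn : ∀ t, ‖circleMap 0 r t‖ = r := fun t => by simp [abs_of_pos hr.1]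
        have hr0 := hr.1
        have hr1 := hr.2
        simp only [hn, lintegral_const, Measure.restrict_apply_univ, Real.volume_Ioc, sub_zero]
        rw [← mul_assoc]
        gcongr
        refine (mul_le_of_le_one_left' (by simpa using hr1.le)).trans
          (ENNReal.ofReal_le_ofReal ?_)
        have h1 : 1 - r ≤ 1 - r ^ 2 := by nlinarith
        rcases le_total s 0 with hs0 | hs0
        · rw [min_eq_left hs0]
          exact Real.rpow_le_rpow_of_nonpos (by linarith) h1 hs0
        · rw [min_eq_right hs0, Real.rpow_zero]
          exact Real.rpow_le_one (by nlinarith) (by nlinarith) hs0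
    _ < ⊤ := by
        rw [lintegral_mul_const' _ _ ENNReal.ofReal_ne_top]
        refine ENNReal.mul_lt_top ?_ ENNReal.ofReal_lt_top
        exact hint.lintegral_lt_top

theorem exists_bergmanSobolevNorm_le {α p : ℝ} (hp : 1 ≤ p)
    (h : p - 1 < α ∨ (α = p - 1 ∧ 2 ≤ p)) :
    ∃ C : ℝ≥0, ∀ f ∈ BMOA, bergmanSobolevNorm p α f ≤ C * bmoaNorm f := by
  obtain ⟨C, hC⟩ : ∃ C : ℝ≥0, ∀ f g, IsCauchyIntegralOf f g →
      bergmanNorm p α (deriv f) ≤ C * eLpNorm g ⊤ arcMeasure := by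
    rcases h with h | ⟨rfl, h⟩
    · have hfin : (∫⁻ u, ENNReal.ofReal ((1 - ‖u‖ ^ 2) ^ (α - p)) ∂diskArea) ^ (1 / p) ≠ ⊤ :=
        ENNReal.rpow_ne_top_of_nonneg (by positivity)
          (lintegral_one_sub_norm_sq_rpow_lt_top (by linarith)).ne
      refine ⟨((∫⁻ u, ENNReal.ofReal ((1 - ‖u‖ ^ 2) ^ (α - p)) ∂diskArea) ^ (1 / p)).toNNReal,
        fun f g hfg => ?_⟩
      rw [ENNReal.coe_toNNReal hfin]
      exact hfg.bergmanNorm_deriv_le_mul hp α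
    · exact ⟨1, fun f g hfg => by simpa using hfg.bergmanNorm_deriv_le_of_two_le h⟩
  -- The summand `1` pays for `|f 0|`. Dividing by the nonzero finite constant isolates the infimum,
  -- so each `g` can be treated separately.
  refine ⟨1 + C, fun f _ => ?_⟩
  have h0 : ((1 + C : ℝ≥0) : ℝ≥0∞) ≠ 0 := by simp
  rw [mul_comm, ← ENNReal.div_le_iff h0 ENNReal.coe_ne_top, bmoaNorm]
  refine le_iInf₂ fun g hfg => ?_
  rw [ENNReal.div_le_iff h0 ENNReal.coe_ne_top, mul_comm, bergmanSobolevNorm, ENNReal.coe_add,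
    add_mul, ENNReal.coe_one, one_mul]
  exact add_le_add hfg.enorm_apply_zero_le (hC f g hfg)

/-! ### Lower bounds for the area integral by lacunary coefficients. -/

/-- For these radii Bernoulli's inequality gives `r ^ n ≥ 1 / 2`, and `(1 - r ^ 2) * n` lies in `[1
/ 6, 1]`. The minimum covers both signs of `α`; `r ^ p ≤ r` absorbs the Jacobian `r`. -/
theorem weight_lower_bound_of_mem_Ioc {α p : ℝ} (hp : 1 ≤ p) {n : ℕ} (hn : 1 ≤ n) {r : ℝ}
    (hr : r ∈ Set.Ioc (1 - 1 / (2 * (n : ℝ))) (1 - 1 / (6 * (n : ℝ)))) :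
    min 1 (6⁻¹ ^ α) * 2⁻¹ ^ p * (n : ℝ) ^ (p - α) ≤
      r * (1 - r ^ 2) ^ α * (n * r ^ (n - 1)) ^ p := by
  have hn0 : (1 : ℝ) ≤ n := by exact_mod_cast hn
  have hnpos : (0 : ℝ) < n := by linarith
  have h2n : 1 / (2 * (n : ℝ)) ≤ 1 / 2 := by gcongr; linarith
  have hr0 : 0 < r := by linarith [hr.1]
  have h6n : 0 < 1 / (6 * (n : ℝ)) := by positivity
  have hr1 : r < 1 := by linarith [hr.2]
  have hrn : 2⁻¹ ≤ r ^ n := by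
    have h1 := one_add_mul_le_pow (a := -(1 / (2 * (n : ℝ)))) (by linarith) n
    have h2 : 1 + (n : ℝ) * -(1 / (2 * (n : ℝ))) = 2⁻¹ := by field_simp; norm_num
    rw [h2] at h1
    refine h1.trans (pow_le_pow_left₀ (by linarith) (by linarith [hr.1]) n)
  have hA : (2⁻¹ : ℝ) ^ p * (n : ℝ) ^ p ≤ r * (n * r ^ (n - 1)) ^ p := by
    rw [Real.mul_rpow hnpos.le (by positivity)]
    have h1 : r ^ p ≤ r := by
      simpa using Real.rpow_le_rpow_of_exponent_ge hr0 hr1.le hp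
    have h2 : (2⁻¹ : ℝ) ^ p ≤ r * (r ^ (n - 1)) ^ p := by
      calc (2⁻¹ : ℝ) ^ p ≤ (r ^ n) ^ p := Real.rpow_le_rpow (by norm_num) hrn (by linarith)
        _ = r ^ p * (r ^ (n - 1)) ^ p := by
          rw [← Real.mul_rpow hr0.le (by positivity), ← pow_succ', Nat.sub_add_cancel hn]
        _ ≤ _ := by gcongr
    calc _ ≤ (r * (r ^ (n - 1)) ^ p) * (n : ℝ) ^ p := by gcongr
      _ = _ := by ring
  have hpos : 0 < 1 - r ^ 2 := by nlinarith
  have hB : min 1 (6⁻¹ ^ α) * (n : ℝ) ^ (-α) ≤ (1 - r ^ 2) ^ α := by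
    have hs1 : (1 - r ^ 2) * n ≤ 1 := by
      have : 1 - r ^ 2 ≤ 1 / n := by
        have : 1 / (2 * (n : ℝ)) = 1 / n / 2 := by field_simp
        nlinarith [hr.1]
      rwa [le_div_iff₀ hnpos] at this
    have hs6 : 6⁻¹ ≤ (1 - r ^ 2) * n := by
      have h1 : 1 / (6 * (n : ℝ)) ≤ 1 - r ^ 2 := by nlinarith [hr.2]
      rw [div_le_iff₀ (by positivity)] at h1
      linarith
    have hs : min 1 (6⁻¹ ^ α) ≤ ((1 - r ^ 2) * n) ^ α := by
      rcases le_total 0 α with h | h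
      · exact (min_le_right _ _).trans (Real.rpow_le_rpow (by norm_num) hs6 h)
      · exact (min_le_left _ _).trans
          (Real.one_le_rpow_of_pos_of_le_one_of_nonpos (by positivity) hs1 h)
    calc _ ≤ ((1 - r ^ 2) * n) ^ α * (n : ℝ) ^ (-α) := by gcongr
      _ = _ := by
        rw [Real.mul_rpow hpos.le hnpos.le, mul_assoc, ← Real.rpow_add hnpos]
        simp
  calc _ = (min 1 (6⁻¹ ^ α) * (n : ℝ) ^ (-α)) * (2⁻¹ ^ p * (n : ℝ) ^ p) := by
        rw [sub_eq_add_neg, Real.rpow_add hnpos]; ring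
    _ ≤ (1 - r ^ 2) ^ α * (r * (n * r ^ (n - 1)) ^ p) := by gcongr
    _ = _ := by ring

/-- Monotonicity of power means for normalized arc length. -/
theorem enorm_circleCoeff_rpow_le {G : ℝ → ℂ} (hG : Continuous G) (n : ℤ) {p : ℝ} (hp : 1 ≤ p) :
    ‖circleCoeff G n‖ₑ ^ p ≤
      (ENNReal.ofReal (2 * Real.pi))⁻¹ * ∫⁻ t in Set.Ioc 0 (2 * Real.pi), ‖G t‖ₑ ^ p := by
  set μ := (ENNReal.ofReal (2 * Real.pi))⁻¹ • volume.restrict (Set.Ioc 0 (2 * Real.pi)) with hμ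
  have : IsProbabilityMeasure μ := ⟨by
    rw [hμ, Measure.smul_apply, Measure.restrict_apply_univ, Real.volume_Ioc, sub_zero,
      smul_eq_mul, ENNReal.inv_mul_cancel (by simp [Real.pi_pos]) ENNReal.ofReal_ne_top]⟩
  have h1 := eLpNorm'_le_eLpNorm'_of_exponent_le (μ := μ) (f := G) one_pos hp
    hG.aestronglyMeasurable
  simp only [eLpNorm', hμ, lintegral_smul_measure, smul_eq_mul, ENNReal.rpow_one, div_one] at h1
  have h2 := (enorm_circleCoeff_le G n).trans h1
  rwa [one_div, ENNReal.le_rpow_inv_iff (by linarith)] at h2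

namespace IsCauchyIntegralOf

variable {f g : ℂ → ℂ}

/-- On the circle of radius `r`, the Fourier coefficient of `f'` of index `n - 1` is `n r ^ (n - 1)`
times that of `g` of index `n`. -/
theorem rpow_mul_enorm_circleCoeff_le (h : IsCauchyIntegralOf f g) {p : ℝ} (hp : 1 ≤ p) {n : ℕ}
    (hn : 1 ≤ n) {r : ℝ} (hr : 0 ≤ r) (hr1 : r < 1) :
    ENNReal.ofReal ((n * r ^ (n - 1)) ^ p) *
      ‖circleCoeff (fun t => g (circleMap 0 1 t)) n‖ₑ ^ p ≤
      (ENNReal.ofReal (2 * Real.pi))⁻¹ *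
        ∫⁻ t in Set.Ioc 0 (2 * Real.pi), ‖deriv f (circleMap 0 r t)‖ₑ ^ p := by
  obtain ⟨m, rfl⟩ := Nat.exists_eq_add_of_le' hn
  have hs := h.summable_norm hr hr1
  have h1 := enorm_circleCoeff_rpow_le (continuous_tsum_exp hs) m hp
  simp_rw [← h.deriv_circleMap_eq hr hr1] at h1
  refine le_trans (le_of_eq ?_) h1
  simp_rw [h.deriv_circleMap_eq hr hr1]
  rw [circleCoeff_tsum hs, ENNReal.ofReal_rpow_of_nonneg (by positivity) (by linarith) |>.symm,
    ← ENNReal.mul_rpow_of_nonneg _ _ (by linarith)]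
  congr 1
  have h2 : ‖((m : ℂ) + 1)‖ = m + 1 := by
    rw [← Nat.cast_add_one, Complex.norm_natCast]; push_cast; rfl
  rw [← ofReal_norm, ← ofReal_norm, ← ENNReal.ofReal_mul (by positivity), norm_mul, norm_mul, h2,
    norm_pow, Complex.norm_real, Real.norm_of_nonneg hr]
  push_cast
  congr 1
  ring

/-- The weighted Dirichlet-type integral of `f` controls the lacunary Fourier coefficients. -/
theorem tsum_circleCoeff_three_pow_le (h : IsCauchyIntegralOf f g) {p : ℝ} (hp : 1 ≤ p) (α : ℝ) :
    ∑' k : ℕ, ENNReal.ofReal (2 / 3 * (min 1 (6⁻¹ ^ α) * 2⁻¹ ^ p) *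
        ((3 ^ k : ℕ) : ℝ) ^ (p - 1 - α)) *
      ‖circleCoeff (fun t => g (circleMap 0 1 t)) (3 ^ k : ℕ)‖ₑ ^ p ≤
    ∫⁻ u, ENNReal.ofReal ((1 - ‖u‖ ^ 2) ^ α) * ‖deriv f u‖ₑ ^ p ∂diskArea := by
  have hm := measurable_deriv f
  rw [lintegral_diskArea (by fun_prop)]
  set H : ℝ → ℝ≥0∞ := fun r => ENNReal.ofReal r * ∫⁻ t in Set.Ioc 0 (2 * Real.pi),
    ENNReal.ofReal ((1 - ‖circleMap 0 r t‖ ^ 2) ^ α) * ‖deriv f (circleMap 0 r t)‖ₑ ^ p with hH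
  -- Since `6 * 3 ^ k = 2 * 3 ^ (k + 1)`, the ranges of radii for `n = 3 ^ k` abut without
  -- overlapping.
  set a : ℕ → ℝ := fun k => 1 - 1 / (2 * ((3 ^ k : ℕ) : ℝ)) with ha
  have ha_succ : ∀ k, a (k + 1) = 1 - 1 / (6 * ((3 ^ k : ℕ) : ℝ)) := fun k => by
    simp only [ha]; push_cast; rw [pow_succ]; ring_nf
  have ha_mono : Monotone a := monotone_nat_of_le_succ fun k => by
    rw [ha_succ]
    simp only [ha]
    have : (0 : ℝ) < (3 ^ k : ℕ) := by positivity
    gcongr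
    norm_num
  have hsub : ⋃ k, Set.Ioc (a k) (a (k + 1)) ⊆ Set.Ioo 0 1 := by
    refine Set.iUnion_subset fun k r hr => ⟨?_, ?_⟩
    · have h0 : a 0 = 1 / 2 := by simp [ha]; norm_num
      have h1 : 0 < a 0 := by rw [h0]; norm_num
      exact h1.trans ((ha_mono (Nat.zero_le k)).trans_lt hr.1)
    · have : (0 : ℝ) < 1 / (2 * ((3 ^ (k + 1) : ℕ) : ℝ)) := by positivity
      have h2 := hr.2
      simp only [ha] at h2
      linarith
  have hdisj : Pairwise (Function.onFun Disjoint fun k => Set.Ioc (a k) (a (k + 1))) :=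
    ha_mono.pairwise_disjoint_on_Ioc_succ
  have hsum : ∑' k, ∫⁻ r in Set.Ioc (a k) (a (k + 1)), H r ≤ ∫⁻ r in Set.Ioo (0 : ℝ) 1, H r := by
    rw [← lintegral_iUnion (fun k => measurableSet_Ioc) hdisj]
    exact lintegral_mono_set hsub
  refine le_trans ?_ (mul_le_mul_right hsum _)
  rw [← ENNReal.tsum_mul_left]
  refine ENNReal.tsum_le_tsum fun k => ?_
  set n : ℕ := 3 ^ k with hn
  have hn1 : 1 ≤ n := Nat.one_le_pow _ _ (by norm_num)
  have hnpos : (0 : ℝ) < n := by exact_mod_cast hn1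
  set c := circleCoeff (fun t => g (circleMap 0 1 t)) n with hc
  set A := min 1 ((6⁻¹ : ℝ) ^ α) * 2⁻¹ ^ p with hA
  have hApos : 0 < A := by positivity
  have hlow : ∀ r ∈ Set.Ioc (a k) (a (k + 1)),
      ENNReal.ofReal (A * (n : ℝ) ^ (p - α)) * (ENNReal.ofReal (2 * Real.pi) * ‖c‖ₑ ^ p) ≤
        H r := fun r hr => by
    have hr01 := hsub (Set.mem_iUnion.2 ⟨k, hr⟩)
    have hr2 : 0 ≤ 1 - r ^ 2 := by nlinarith [hr01.1, hr01.2]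
    rw [ha_succ] at hr
    have h1 := weight_lower_bound_of_mem_Ioc (α := α) hp hn1 hr
    have h2 := h.rpow_mul_enorm_circleCoeff_le hp hn1 hr01.1.le hr01.2
    have hnorm : ∀ t, ‖circleMap 0 r t‖ = r := fun t => by simp [abs_of_pos hr01.1]
    simp only [hH, hnorm]
    rw [lintegral_const_mul' _ _ ENNReal.ofReal_ne_top]
    rw [← ENNReal.div_eq_inv_mul, ENNReal.le_div_iff_mul_le
      (Or.inl (by simp [Real.pi_pos])) (Or.inl ENNReal.ofReal_ne_top)] at h2
    have hr0 := hr01.1.le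
    calc _ ≤ ENNReal.ofReal (r * (1 - r ^ 2) ^ α * (n * r ^ (n - 1)) ^ p) *
          (ENNReal.ofReal (2 * Real.pi) * ‖c‖ₑ ^ p) := by gcongr
      _ = ENNReal.ofReal r * (ENNReal.ofReal ((1 - r ^ 2) ^ α) *
          (ENNReal.ofReal ((n * r ^ (n - 1)) ^ p) * ‖c‖ₑ ^ p * ENNReal.ofReal (2 * Real.pi))) := by
        rw [ENNReal.ofReal_mul (by positivity), ENNReal.ofReal_mul (by positivity)]
        ring
      _ ≤ _ := by gcongr
  have hlen : volume (Set.Ioc (a k) (a (k + 1))) = ENNReal.ofReal (1 / (3 * n)) := by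
    rw [Real.volume_Ioc, ha_succ]
    congr 1
    simp only [ha]
    rw [← hn]
    field_simp
    ring
  -- The factor `2 / 3` is `π⁻¹ * 2π * (1 / 3)`, and the width `1 / (3 n)` lowers the exponent `p -
  -- α` to `p - 1 - α`.
  calc _ = (ENNReal.ofReal Real.pi)⁻¹ * (ENNReal.ofReal (A * (n : ℝ) ^ (p - α)) *
        (ENNReal.ofReal (2 * Real.pi) * ‖c‖ₑ ^ p) * volume (Set.Ioc (a k) (a (k + 1)))) := by
        rw [hlen, ← ENNReal.ofReal_inv_of_pos Real.pi_pos]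
        have e : ∀ x y z w : ℝ≥0∞, x * (y * (z * ‖c‖ₑ ^ p) * w) = x * y * z * w * ‖c‖ₑ ^ p :=
          fun x y z w => by ring
        have hpi := Real.pi_pos
        rw [e, ← ENNReal.ofReal_mul (by positivity), ← ENNReal.ofReal_mul (by positivity),
          ← ENNReal.ofReal_mul (by positivity)]
        congr 2
        rw [show p - α = (p - 1 - α) + 1 by ring, Real.rpow_add_one hnpos.ne']
        field_simp
    _ ≤ _ := by
        gcongr
        rw [← setLIntegral_const]
        exact setLIntegral_mono' measurableSet_Ioc hlow

theorem summable_circleCoeff_three_pow (h : IsCauchyIntegralOf f g) {p : ℝ} (hp : 1 ≤ p) {α : ℝ}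
    (hf : bergmanSobolevNorm p α f < ⊤) :
    Summable fun k : ℕ => ((3 ^ k : ℕ) : ℝ) ^ (p - 1 - α) *
      ‖circleCoeff (fun t => g (circleMap 0 1 t)) (3 ^ k : ℕ)‖ ^ p := by
  have hp0 : 0 < p := by linarith
  have h1 : ∫⁻ u, ENNReal.ofReal ((1 - ‖u‖ ^ 2) ^ α) * ‖deriv f u‖ₑ ^ p ∂diskArea < ⊤ := by
    have h2 : bergmanNorm p α (deriv f) < ⊤ := lt_of_le_of_lt le_add_self hf
    rwa [bergmanNorm, ENNReal.rpow_lt_top_iff_of_pos (by positivity)] at h2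
  have h3 := ENNReal.summable_toReal
    ((h.tsum_circleCoeff_three_pow_le hp α).trans_lt h1).ne
  have hA : 2 / 3 * (min 1 ((6⁻¹ : ℝ) ^ α) * 2⁻¹ ^ p) ≠ 0 := by positivity
  rw [← summable_mul_left_iff hA]
  refine h3.congr fun k => ?_
  rw [ENNReal.toReal_mul, ENNReal.toReal_ofReal (by positivity), ← ENNReal.toReal_rpow,
    toReal_enorm]
  ring

end IsCauchyIntegralOf

/-! ### Coefficient functionals and test functions: characters and Riesz products. -/

/-- The Fourier coefficients of the restriction to the circle of a bounded continuous function, as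
a functional. -/
noncomputable def circleCoeffCLM (n : ℤ) : (ℂ →ᵇ ℂ) →L[ℂ] ℂ :=
  LinearMap.mkContinuous
    { toFun := fun φ => circleCoeff (fun t => φ (circleMap 0 1 t)) n
      map_add' := fun φ ψ => circleCoeff_add (by fun_prop) (by fun_prop) n
      map_smul' := fun c φ => circleCoeff_const_mul c _ n } 1 fun φ => by
    rw [one_mul]
    exact norm_circleCoeff_le (fun t => φ.norm_coe_le_norm _) n

theorem circleCoeffCLM_apply (n : ℤ) (φ : ℂ →ᵇ ℂ) :
    circleCoeffCLM n φ = circleCoeff (fun t => φ (circleMap 0 1 t)) n := rfl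

/-- The Cauchy integral of a function on the circle. -/
noncomputable def cauchyIntegral (φ : ℂ → ℂ) (ξ : ℂ) : ℂ :=
  (2 * Real.pi * Complex.I)⁻¹ * ∮ u in C(0, 1), φ u / (u - ξ)

theorem isCauchyIntegralOf_cauchyIntegral (φ : ℂ →ᵇ ℂ) :
    IsCauchyIntegralOf (cauchyIntegral φ) φ :=
  ⟨memLp_top_of_bound φ.continuous.aestronglyMeasurable ‖φ‖
    (Filter.Eventually.of_forall φ.norm_coe_le_norm), fun _ _ => rfl⟩

theorem IsCauchyIntegralOf.mem_BMOA {f g : ℂ → ℂ} (h : IsCauchyIntegralOf f g) : f ∈ BMOA :=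
  ⟨h.differentiableOn, (iInf₂_le g h).trans_lt h.eLpNorm_lt_top⟩

/-- The radial retraction of the plane onto the closed unit disc. -/
noncomputable def discRetract (z : ℂ) : ℂ := z / (max 1 ‖z‖ : ℝ)

theorem continuous_discRetract : Continuous discRetract := by
  refine Continuous.div continuous_id (by fun_prop) fun z => ?_
  exact_mod_cast (lt_of_lt_of_le one_pos (le_max_left 1 ‖z‖)).ne'

theorem norm_discRetract_le (z : ℂ) : ‖discRetract z‖ ≤ 1 := by
  have : 0 < max 1 ‖z‖ := lt_of_lt_of_le one_pos (le_max_left 1 ‖z‖)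
  rw [discRetract, norm_div, Complex.norm_real, Real.norm_of_nonneg this.le, div_le_one this]
  exact le_max_right _ _

theorem discRetract_circleMap (t : ℝ) :
    discRetract (circleMap 0 1 t) = Complex.exp (t * Complex.I) := by
  rw [discRetract, norm_circleMap_zero, abs_one, max_self, circleMap_zero]
  simp

/-- A bounded continuous function which is the character `u ↦ u ^ n` on the circle. -/
noncomputable def discCharacter (n : ℕ) : ℂ →ᵇ ℂ :=
  BoundedContinuousFunction.ofNormedAddCommGroup (fun z => discRetract z ^ n)
    (continuous_discRetract.pow n) 1 fun z => by
      rw [norm_pow]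
      exact pow_le_one₀ (norm_nonneg _) (norm_discRetract_le z)

theorem norm_discCharacter_le (n : ℕ) : ‖discCharacter n‖ ≤ 1 :=
  BoundedContinuousFunction.norm_ofNormedAddCommGroup_le _ zero_le_one _

theorem circleCoeffCLM_discCharacter (n : ℕ) : circleCoeffCLM n (discCharacter n) = 1 := by
  have h := circleCoeff_exp n n
  rw [if_pos rfl] at h
  rw [circleCoeffCLM_apply, ← h]
  refine circleCoeff_congr (fun t => ?_) _
  simp [discCharacter, discRetract_circleMap, ← Complex.exp_nat_mul, mul_assoc]

/-- The partial **Riesz product** `∏ (1 + i bₖ cos (3 ^ k t))`, extended from the circle to the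
plane. -/
noncomputable def rieszProduct (b : ℕ → ℝ) (K : ℕ) (z : ℂ) : ℂ :=
  ∏ k ∈ Finset.range K, (1 + (b k * (discRetract z ^ 3 ^ k).re : ℝ) * Complex.I)

theorem continuous_rieszProduct (b : ℕ → ℝ) (K : ℕ) : Continuous (rieszProduct b K) := by
  have := continuous_discRetract
  unfold rieszProduct
  refine continuous_finsetProd _ fun k _ => ?_
  fun_prop

/-- Each factor is `1 + i y` with `|y| ≤ |b k|`, of modulus `√(1 + y²) ≤ exp (b k ^ 2 / 2)`. The
imaginary unit makes the growth quadratic in `b k`. -/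
theorem norm_rieszProduct_le (b : ℕ → ℝ) (K : ℕ) (z : ℂ) :
    ‖rieszProduct b K z‖ ≤ Real.exp ((∑ k ∈ Finset.range K, b k ^ 2) / 2) := by
  rw [rieszProduct, norm_prod, Finset.sum_div, Real.exp_sum]
  refine Finset.prod_le_prod (fun _ _ => norm_nonneg _) fun k _ => ?_
  have h1 : |(discRetract z ^ 3 ^ k).re| ≤ 1 := by
    refine (Complex.abs_re_le_norm _).trans ?_
    rw [norm_pow]
    exact pow_le_one₀ (norm_nonneg _) (norm_discRetract_le z)
  have h2 : (discRetract z ^ 3 ^ k).re ^ 2 ≤ 1 := (sq_le_one_iff_abs_le_one _).2 h1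
  have h3 : ‖(1 + (b k * (discRetract z ^ 3 ^ k).re : ℝ) * Complex.I : ℂ)‖ =
      √(1 ^ 2 + (b k * (discRetract z ^ 3 ^ k).re) ^ 2) := by
    have := Complex.norm_add_mul_I 1 (b k * (discRetract z ^ 3 ^ k).re)
    simpa using this
  rw [h3, ← Real.sqrt_sq (Real.exp_pos _).le, ← Real.exp_nat_mul]
  refine Real.sqrt_le_sqrt ?_
  have h4 := Real.add_one_le_exp (b k ^ 2)
  have h5 : ((2 : ℕ) : ℝ) * (b k ^ 2 / 2) = b k ^ 2 := by push_cast; ring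
  rw [h5]
  nlinarith [sq_nonneg (b k)]

/-- The Riesz product as a bounded continuous function. -/
noncomputable def rieszProductBCF (b : ℕ → ℝ) (K : ℕ) : ℂ →ᵇ ℂ :=
  BoundedContinuousFunction.ofNormedAddCommGroup (rieszProduct b K) (continuous_rieszProduct b K)
    _ (norm_rieszProduct_le b K)

theorem norm_rieszProductBCF_le (b : ℕ → ℝ) (K : ℕ) :
    ‖rieszProductBCF b K‖ ≤ Real.exp ((∑ k ∈ Finset.range K, b k ^ 2) / 2) :=
  BoundedContinuousFunction.norm_ofNormedAddCommGroup_le _ (Real.exp_pos _).le _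

/-- The new cosine is half the sum of the characters of index `± 3 ^ K`, so it adds two translates
of the old spectrum. -/
theorem circleCoeff_rieszProduct_succ (b : ℕ → ℝ) (K : ℕ) (n : ℤ) :
    circleCoeff (fun t => rieszProduct b (K + 1) (circleMap 0 1 t)) n =
      circleCoeff (fun t => rieszProduct b K (circleMap 0 1 t)) n + b K * Complex.I / 2 *
        (circleCoeff (fun t => rieszProduct b K (circleMap 0 1 t)) (n - 3 ^ K) +
          circleCoeff (fun t => rieszProduct b K (circleMap 0 1 t)) (n + 3 ^ K)) := by
  have hc : Continuous fun t => rieszProduct b K (circleMap 0 1 t) :=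
    (continuous_rieszProduct b K).comp (by fun_prop)
  rw [show n + 3 ^ K = n - -3 ^ K by ring, ← circleCoeff_exp_mul, ← circleCoeff_exp_mul,
    ← circleCoeff_add (by fun_prop) (by fun_prop), ← circleCoeff_const_mul,
    ← circleCoeff_add (by fun_prop) (by fun_prop)]
  refine circleCoeff_congr (fun t => ?_) n
  rw [rieszProduct, Finset.prod_range_succ, ← rieszProduct, discRetract_circleMap,
    ← Complex.exp_nat_mul]
  have h1 : ((Complex.exp ((3 ^ K : ℕ) * (t * Complex.I))).re : ℂ) =
      (Complex.exp ((3 ^ K : ℤ) * t * Complex.I) +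
        Complex.exp ((-3 ^ K : ℤ) * t * Complex.I)) / 2 := by
    rw [Complex.re_eq_add_conj, ← Complex.exp_conj]
    simp [mul_assoc, Complex.conj_ofNat]
  push_cast at h1 ⊢
  rw [h1]
  ring

theorem circleCoeff_rieszProduct_zero (b : ℕ → ℝ) (n : ℤ) :
    circleCoeff (fun t => rieszProduct b 0 (circleMap 0 1 t)) n = if n = 0 then 1 else 0 := by
  have h := circleCoeff_exp n 0
  simpa [rieszProduct, eq_comm] using h

/-- The frequencies are sums of distinct terms `± 3 ^ k` with `k < K`, hence at most `(3 ^ K - 1) /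
2` in absolute value. -/
theorem circleCoeff_rieszProduct_eq_zero (b : ℕ → ℝ) (K : ℕ) (n : ℤ) (hn : 3 ^ K ≤ 2 * |n|) :
    circleCoeff (fun t => rieszProduct b K (circleMap 0 1 t)) n = 0 := by
  induction K generalizing n with
  | zero =>
    rw [circleCoeff_rieszProduct_zero, if_neg]
    rintro rfl
    simp at hn
  | succ K ih =>
    have h3 : (0 : ℤ) < 3 ^ K := by positivity
    rw [pow_succ] at hn
    rw [circleCoeff_rieszProduct_succ, ih, ih, ih]
    · simp
    all_goals grind

theorem circleCoeff_rieszProduct_at_zero (b : ℕ → ℝ) (K : ℕ) :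
    circleCoeff (fun t => rieszProduct b K (circleMap 0 1 t)) 0 = 1 := by
  induction K with
  | zero => simp [circleCoeff_rieszProduct_zero]
  | succ K ih =>
    have h3 : (0 : ℤ) < 3 ^ K := by positivity
    rw [circleCoeff_rieszProduct_succ, ih, circleCoeff_rieszProduct_eq_zero,
      circleCoeff_rieszProduct_eq_zero]
    · simp
    all_goals grind

/-- The factor of index `j` creates this coefficient from the constant term `1`. Later factors leave
it alone, because `3 ^ j ± 3 ^ K` lies outside the spectrum of the first `K` factors when `j < K`.
-/
theorem circleCoeff_rieszProduct_three_pow (b : ℕ → ℝ) {j K : ℕ} (h : j < K) :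
    circleCoeff (fun t => rieszProduct b K (circleMap 0 1 t)) (3 ^ j) = b j * Complex.I / 2 := by
  induction K with
  | zero => omega
  | succ K ih =>
    have h3 : (0 : ℤ) < 3 ^ K := by positivity
    rw [circleCoeff_rieszProduct_succ]
    rcases Nat.lt_succ_iff_lt_or_eq.1 h with hj | rfl
    · have h4 : (3 : ℤ) * 3 ^ j ≤ 3 ^ K := by
        rw [← pow_succ']
        exact pow_le_pow_right₀ (by norm_num) hj
      have h5 : (0 : ℤ) < 3 ^ j := by positivity
      rw [ih hj, circleCoeff_rieszProduct_eq_zero, circleCoeff_rieszProduct_eq_zero]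
      · simp
      all_goals grind
    · rw [sub_self, circleCoeff_rieszProduct_at_zero, circleCoeff_rieszProduct_eq_zero,
        circleCoeff_rieszProduct_eq_zero]
      · simp
      all_goals grind

/-! ### Necessity by Banach–Steinhaus. -/

theorem summable_of_BMOA_subset {p α : ℝ} (hp : 1 ≤ p) (h : BMOA ⊆ bergmanSobolev p α)
    (φ : ℂ →ᵇ ℂ) :
    Summable fun k : ℕ => ((3 ^ k : ℕ) : ℝ) ^ (p - 1 - α) * ‖circleCoeffCLM (3 ^ k : ℕ) φ‖ ^ p :=
  have hφ := isCauchyIntegralOf_cauchyIntegral φ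
  hφ.summable_circleCoeff_three_pow hp (h hφ.mem_BMOA).2

theorem le_of_BMOA_subset {p α : ℝ} (hp : 1 ≤ p) (h : BMOA ⊆ bergmanSobolev p α) :
    p - 1 ≤ α := by
  by_contra! hα
  have hp0 : 0 < p := by linarith
  -- With this `β`, the `p`-th power of each functional's modulus is a term of the convergent
  -- series, which gives pointwise boundedness.
  set β := (p - 1 - α) / p with hβ
  have hβpos : 0 < β := div_pos (by linarith) hp0
  obtain ⟨C, hC⟩ := banach_steinhaus
    (g := fun k : ℕ => ((((3 ^ k : ℕ) : ℝ) ^ β : ℝ) : ℂ) • circleCoeffCLM (3 ^ k : ℕ)) fun φ => by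
      have hs := summable_of_BMOA_subset hp h φ
      refine ⟨(∑' k : ℕ, ((3 ^ k : ℕ) : ℝ) ^ (p - 1 - α) *
        ‖circleCoeffCLM (3 ^ k : ℕ) φ‖ ^ p) ^ (1 / p), fun k => ?_⟩
      rw [smul_apply, norm_smul, Complex.norm_real, Real.norm_of_nonneg (by positivity), one_div,
        Real.le_rpow_inv_iff_of_pos (by positivity) (tsum_nonneg fun k => by positivity) hp0,
        Real.mul_rpow (by positivity) (by positivity), ← Real.rpow_mul (by positivity), hβ,
        div_mul_cancel₀ _ hp0.ne']
      exact hs.le_tsum k fun _ _ => by positivity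
  have h1 : ∀ k : ℕ, ((3 ^ k : ℕ) : ℝ) ^ β ≤ C := fun k => by
    have h2 := ((((((3 ^ k : ℕ) : ℝ) ^ β : ℝ) : ℂ) • circleCoeffCLM (3 ^ k : ℕ)).le_opNorm
      (discCharacter (3 ^ k)))
    rw [smul_apply, circleCoeffCLM_discCharacter, norm_smul, Complex.norm_real,
      Real.norm_of_nonneg (by positivity), norm_one, mul_one] at h2
    have h3 := hC k
    have h4 := norm_discCharacter_le (3 ^ k)
    calc _ ≤ _ := h2
      _ ≤ C * 1 := by gcongr; exact (norm_nonneg _).trans h3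
      _ = C := mul_one C
  have ht : Filter.Tendsto (fun k : ℕ => ((3 ^ k : ℕ) : ℝ) ^ β) Filter.atTop Filter.atTop :=
    (tendsto_rpow_atTop hβpos).comp (tendsto_natCast_atTop_atTop.comp
      (tendsto_pow_atTop_atTop_of_one_lt (by norm_num)))
  obtain ⟨k, hk⟩ := (ht.eventually_gt_atTop C).exists
  exact absurd (h1 k) (not_le.2 hk)

/-- If `p < 2`, pairing the lacunary coefficients with a sequence in `ℓ^q'` but not in `ℓ²` gives
pointwise bounded functionals, by Hölder, that are not uniformly bounded on Riesz products. -/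
theorem two_le_of_BMOA_subset {p : ℝ} (hp : 1 ≤ p) (h : BMOA ⊆ bergmanSobolev p (p - 1)) :
    2 ≤ p := by
  by_contra! hp2
  -- A midpoint is used because `p = 1` is allowed: `q > 1` keeps the conjugate exponent finite, and
  -- `q < 2` makes it exceed `2`.
  set q := (p + 2) / 2 with hq
  have hq1 : 1 < q := by linarith
  have hq2 : q < 2 := by linarith
  set b : ℕ → ℝ := fun k => ((k : ℝ) + 1) ^ (-(1 / 2) : ℝ) with hb
  have hb0 : ∀ k, 0 ≤ b k := fun k => by positivity
  have hb2 : ∀ k, b k ^ 2 = 1 / ((k : ℝ) + 1) := fun k => by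
    rw [hb, ← Real.rpow_natCast, ← Real.rpow_mul (by positivity)]
    norm_num
    rw [Real.rpow_neg_one]
  have hpq := Real.HolderConjugate.conjExponent hq1
  have hbs : Summable fun k => b k ^ q.conjExponent := by
    have hq' : 1 < q.conjExponent / 2 := by
      rw [Real.conjExponent, lt_div_iff₀ two_pos, lt_div_iff₀ (by linarith)]
      linarith
    have := (summable_nat_add_iff 1).2 (Real.summable_one_div_nat_rpow.2 hq')
    refine this.congr fun k => ?_
    rw [hb, ← Real.rpow_mul (by positivity), one_div, ← Real.rpow_neg (by positivity)]
    push_cast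
    congr 1
    ring
  obtain ⟨C, hC⟩ := banach_steinhaus
    (g := fun K : ℕ => ∑ k ∈ Finset.range K, (b k : ℂ) • circleCoeffCLM (3 ^ k : ℕ)) fun φ => by
      have hs := summable_of_BMOA_subset hp h φ
      simp only [sub_self, Real.rpow_zero, one_mul] at hs
      have hx0 : ∀ k : ℕ, 0 ≤ ‖circleCoeffCLM (3 ^ k : ℕ) φ‖ := fun k => norm_nonneg _
      -- The terms tend to `0`, so they are eventually at most `1` and raising the exponent from `p`
      -- to `q` preserves summability.
      have hsq : Summable fun k : ℕ => ‖circleCoeffCLM (3 ^ k : ℕ) φ‖ ^ q := by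
        refine Summable.of_norm_bounded_eventually_nat hs ?_
        filter_upwards [hs.tendsto_atTop_zero.eventually (gt_mem_nhds one_pos)] with k hk
        rw [Real.norm_of_nonneg (by positivity)]
        have hx1 : ‖circleCoeffCLM (3 ^ k : ℕ) φ‖ ≤ 1 := by
          by_contra! hcon
          exact absurd hk (not_lt.2 (Real.one_le_rpow hcon.le (by linarith)))
        exact Real.rpow_le_rpow_of_exponent_ge' (hx0 k) hx1 (by linarith) (by linarith)
      have hmul := Real.summable_mul_of_Lp_Lq_of_nonneg hpq.symm hb0 hx0 hbs hsq
      refine ⟨∑' k : ℕ, b k * ‖circleCoeffCLM (3 ^ k : ℕ) φ‖, fun K => ?_⟩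
      rw [sum_apply]
      refine (norm_sum_le _ _).trans (le_trans (Finset.sum_le_sum fun k _ => ?_)
        (hmul.sum_le_tsum (Finset.range K) fun k _ => mul_nonneg (hb0 k) (hx0 k)))
      rw [smul_apply, norm_smul, Complex.norm_real, Real.norm_of_nonneg (hb0 k)]
  set S : ℕ → ℝ := fun K => ∑ k ∈ Finset.range K, b k ^ 2 with hS
  have hbound : ∀ K, 0 < S K → √(S K) ≤ 2 * (C * Real.exp (1 / 2)) := fun K hK => by
    -- This scaling gives `t b` unit `ℓ²` norm on the first `K` indices, so the Riesz product is
    -- bounded by `exp (1 / 2)`, while the functional takes a value of modulus `√(S K) / 2`.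
    set t := (√(S K))⁻¹ with ht
    have hsq : √(S K) ^ 2 = S K := Real.sq_sqrt hK.le
    have hsqpos : 0 < √(S K) := Real.sqrt_pos.2 hK
    set φ := rieszProductBCF (fun k => t * b k) K with hφ
    have hφn : ‖φ‖ ≤ Real.exp (1 / 2) := by
      refine (norm_rieszProductBCF_le _ _).trans (le_of_eq ?_)
      congr 2
      simp_rw [mul_pow, ← Finset.mul_sum]
      change t ^ 2 * S K = 1
      rw [ht, inv_pow, hsq, inv_mul_cancel₀ hK.ne']
    have hval : (∑ k ∈ Finset.range K, (b k : ℂ) • circleCoeffCLM (3 ^ k : ℕ)) φ =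
        ((t * S K / 2 : ℝ) : ℂ) * Complex.I := by
      rw [sum_apply]
      have : ∀ k ∈ Finset.range K, ((b k : ℂ) • circleCoeffCLM (3 ^ k : ℕ)) φ =
          ((t / 2 * b k ^ 2 : ℝ) : ℂ) * Complex.I := fun k hk => by
        have h1 := circleCoeff_rieszProduct_three_pow (fun k => t * b k) (Finset.mem_range.1 hk)
        have h2 : circleCoeffCLM (3 ^ k : ℕ) φ = ((t * b k : ℝ) : ℂ) * Complex.I / 2 := by
          rw [← h1]
          push_cast
          rfl
        rw [smul_apply, h2, smul_eq_mul]
        push_cast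
        ring
      rw [Finset.sum_congr rfl this, ← Finset.sum_mul, ← Complex.ofReal_sum, ← Finset.mul_sum]
      congr 2
      ring
    have hle := (∑ k ∈ Finset.range K, (b k : ℂ) • circleCoeffCLM (3 ^ k : ℕ)).le_opNorm φ
    rw [hval, norm_mul, Complex.norm_I, mul_one, Complex.norm_real,
      Real.norm_of_nonneg (by positivity)] at hle
    have hts : t * S K = √(S K) := by
      rw [ht, inv_mul_eq_iff_eq_mul₀ hsqpos.ne', ← sq, hsq]
    rw [hts] at hle
    have hC' := hC K
    have : √(S K) / 2 ≤ C * Real.exp (1 / 2) := by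
      refine hle.trans ?_
      gcongr
      exact (norm_nonneg _).trans hC'
    linarith
  -- The sums `S K` are the partial sums of the harmonic series.
  have hSt : Filter.Tendsto S Filter.atTop Filter.atTop := by
    simp only [hS, hb2]
    exact Real.tendsto_sum_range_one_div_nat_succ_atTop
  obtain ⟨K, hK1, hK2⟩ := ((hSt.eventually_gt_atTop 0).and
    ((Real.tendsto_sqrt_atTop.comp hSt).eventually_gt_atTop (2 * (C * Real.exp (1 / 2))))).exists
  exact absurd (hbound K hK1) (not_le.2 hK2)

theorem BMOA_subset_bergmanSobolev {α p : ℝ} (hp : 1 ≤ p)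
    (h : p - 1 < α ∨ (α = p - 1 ∧ 2 ≤ p)) : BMOA ⊆ bergmanSobolev p α := by
  obtain ⟨C, hC⟩ := exists_bergmanSobolevNorm_le hp h
  exact fun f hf => ⟨hf.1, (hC f hf).trans_lt (ENNReal.mul_lt_top ENNReal.coe_lt_top hf.2)⟩

theorem proposition2p1 (α p : ℝ) (hα : -1 < α) (hp : 1 ≤ p) :
    (BMOA ⊆ bergmanSobolev p α ↔ (p - 1 < α ∨ (α = p - 1 ∧ 2 ≤ p))) ∧
    (BMOA ⊆ bergmanSobolev p α →
      ∃ C : ℝ≥0, ∀ f ∈ BMOA, bergmanSobolevNorm p α f ≤ C * bmoaNorm f) := by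
  have key : BMOA ⊆ bergmanSobolev p α → (p - 1 < α ∨ (α = p - 1 ∧ 2 ≤ p)) := fun h => by
    rcases (le_of_BMOA_subset hp h).lt_or_eq with h1 | rfl
    · exact Or.inl h1
    · exact Or.inr ⟨rfl, two_le_of_BMOA_subset hp h⟩
  exact ⟨⟨key, BMOA_subset_bergmanSobolev hp⟩, fun h => exists_bergmanSobolevNorm_le hp (key h)⟩
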